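/- **Theorem 5.1 (general estimate).** Let $m\ge 1$ be an integer, let $d:\mathbb N^*\to\mathbb R$ and $a_1,\dots,a_m:\mathbb N^*\to\mathbb R$, with the convention $a_l(j)=0$ for $j\le 0$, and assume $$d(n)\to\infty,\qquad \frac{|a_l(j-l)|+|a_l(j)|}{d(j)}\xrightarrow[j\to\infty]{}0\quad(1\le l\le m),$$ and $d(n)<d(n+1)$ for all large $n$. In $\ell^2=\ell^2(\mathbb N^*;\mathbb C)$ let $\mathcal D=\{x\in\ell^2:\sum_j|d(j)x(j)|^2<\infty\}$ and let $A=D+A':\mathcal D\to\ell^2$, where $$(Dx)(j)=d(j)x(j),\qquad (A'x)(j)=\sum_{1\le l\le m}\bigl(a_l(j)x(j+l)+a_l(j-l)x(j-l)\bigr),$$ and $x(j)=0$ for $j\le 0$. For an operator $T$ on $\mathcal D$ of this kind, $(\lambda_n(T))_{n\ge 1}$ denotes its nondecreasing sequence of eigenvalues with multiplicity: $\lambda_n(T)\le\lambda_{n+1}(T)$, $\lambda_n(T)\to\infty$, and $\ell^2$ has an orthonormal basis $(v_n)_{n\ge 1}$ in $\mathcal D$ with $Tv_n=\lambda_n(T)v_n$.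 Let $(\tau_n)_{n\ge1}$ be a nondecreasing sequence of positive integers with $\tau_n\to\infty$ and $n-2\tau_n\to\infty$. Let $\chi\in C^1(\mathbb R)$ satisfy $0\le\chi\le1$, $\chi=1$ on $[-1,1]$, $\chi=0$ outside $[-2,2]$, and $|\chi'|\le 2$. Put $\tilde a_{n,l}(j)=a_l(j)\bigl(1-\chi(\tfrac{j-n}{\tau_n})\bigr)$ (and $\tilde a_{n,l}(j)=0$ for $j\le 0$), and let $\tilde A_n$ be the operator defined as $A'$ with $\tilde a_{n,l}$ in place of $a_l$. Assume $$d(n)=\lambda_n(D+\tilde A_n)\quad\text{for all large } n.$$ With $(\Delta x)(n)=x(n+1)-x(n)$ and $s\ge 0$ put $$\alpha_s(j)=\max_{1\le l\le m,\ |i|\le s}|a_l(j+i)|,\qquad \tilde\alpha_{n,s}(j)=\frac{2\alpha_s(j)}{\tau_n}+\max_{1\le l\le m,\ |i|\le s}|(\Delta a_l)(j+i)|,$$ $$\gamma_s(j)=\min_{|i|\le s+1}(\Delta d)(j+i),\qquad \tilde\gamma_s(j)=\max_{|i|\le s}|(\Delta^2d)(j+i)|,$$ $$\rho_n(j)=2\tilde\alpha_{n,4m}(j)\frac{\alpha_{4m}(j)}{\gamma_{4m}(j)}+m\,\tilde\gamma_{5m}(j)\frac{\alpha_{4m}(j)^2}{\gamma_{4m}(j)^2}.$$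 Then the eigenvalue sequence $(\lambda_n(A))_{n\ge1}$ exists, and there is $n_1$ such that for all $n\ge n_1$ $$|\lambda_n(A)-d(n)|\le 15\,m^3\sup_{|i|\le 2\tau_n+4m}\rho_n(n+i).$$ (For large $n$ only values of $d$ at positive indices enter, and all the denominators are positive.) -/

import Mathlib

open Filter Topology

noncomputable section

namespace BandMatrix

/-- The Hilbert space of square summable complex sequences indexed by the positive integers. -/
abbrev Ell2 : Type := lp (fun _ : ℕ+ => ℂ) 2

/-- Extension of a sequence on the positive integers to all integers by zero. -/
def ext {E : Type*} [Zero E] (x : ℕ+ → E) (j : ℤ) : E :=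
  if 0 < j then x j.toNat.toPNat' else 0

/-- The forward difference `(Δ x)(j) = x (j + 1) - x j`. -/
def fdiff (x : ℤ → ℝ) (j : ℤ) : ℝ := x (j + 1) - x j

/-- The coefficients are small compared with the diagonal:
`(|a_l (j - l)| + |a_l j|) / d j → 0` for `l = 1, …, m`. -/
def OffDiagSmall (m : ℕ) (a : ℕ → ℕ+ → ℝ) (d : ℕ+ → ℝ) : Prop :=
  ∀ l ∈ Finset.Icc 1 m,
    Tendsto (fun j : ℕ+ => (|ext (a l) ((j : ℤ) - l)| + |a l j|) / d j) atTop (𝓝 0)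

/-- The domain `{x ∈ ℓ² : ∑ |d j x j|² < ∞}` of the diagonal operator. -/
def diagDomain (d : ℕ+ → ℝ) : Submodule ℂ Ell2 where
  carrier := {x | Memℓp (fun j => (d j : ℂ) * x j) 2}
  zero_mem' := by
    have h : (fun j : ℕ+ => (d j : ℂ) * (0 : Ell2) j) = 0 := by
      funext j; simp
    simpa only [Set.mem_ofPred_eq, h] using (zero_memℓp : Memℓp (0 : ∀ _ : ℕ+, ℂ) 2)
  add_mem' := by
    intro x y hx hy
    have h : (fun j : ℕ+ => (d j : ℂ) * (x + y : Ell2) j)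
        = (fun j => (d j : ℂ) * x j) + fun j => (d j : ℂ) * y j := by
      funext j; simp [mul_add]
    simpa only [Set.mem_ofPred_eq, h] using Memℓp.add hx hy
  smul_mem' := by
    intro c x hx
    have h : (fun j : ℕ+ => (d j : ℂ) * (c • x : Ell2) j)
        = c • fun j => (d j : ℂ) * x j := by
      funext j; simp [mul_left_comm]
    simpa only [Set.mem_ofPred_eq, h] using Memℓp.const_smul hx c

/-- The action of the off-diagonal part on sequences:
`(A' x)(j) = ∑_{1 ≤ l ≤ m} (a_l j x (j + l) + a_l (j - l) x (j - l))`,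
where terms with `j - l ≤ 0` are zero. -/
def offDiagAction (m : ℕ) (a : ℕ → ℕ+ → ℝ) (x : ℕ+ → ℂ) (j : ℕ+) : ℂ :=
  ∑ l ∈ Finset.Icc 1 m,
    ((a l j : ℂ) * ext x ((j : ℤ) + l)
      + ((ext (a l) ((j : ℤ) - l) : ℝ) : ℂ) * ext x ((j : ℤ) - l))

theorem ext_coe {E : Type*} [Zero E] (x : ℕ+ → E) (j : ℕ+) : ext x (j : ℤ) = x j := by
  have h : (0 : ℤ) < (j : ℤ) := by exact_mod_cast j.pos
  rw [ext, if_pos h, Int.toNat_natCast, PNat.coe_toPNat']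

theorem ext_of_nonpos {E : Type*} [Zero E] (x : ℕ+ → E) {j : ℤ} (h : j ≤ 0) : ext x j = 0 := by
  rw [ext, if_neg (by omega)]

theorem ext_cases (j : ℤ) : j ≤ 0 ∨ ∃ k : ℕ+, (k : ℤ) = j := by
  rcases le_or_gt j 0 with h | h
  · exact Or.inl h
  · refine Or.inr ⟨⟨j.toNat, by omega⟩, ?_⟩
    simp only [PNat.mk_coe]
    omega

theorem summable_ext {f : ℕ+ → ℝ} (hf : Summable f) : Summable (ext f) := by
  have hinj : Function.Injective (fun k : ℕ+ => (k : ℤ)) := by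
    intro p q h
    have h' : (p : ℤ) = (q : ℤ) := h
    exact PNat.coe_injective (by exact_mod_cast h')
  rw [← hinj.summable_iff (f := ext f)]
  · convert hf using 1
    funext k
    exact ext_coe f k
  · intro j hj
    rcases ext_cases j with h | ⟨k, hk⟩
    · exact ext_of_nonpos f h
    · exact absurd ⟨k, hk⟩ hj

theorem OffDiagSmall.bound {m : ℕ} {a : ℕ → ℕ+ → ℝ} {d : ℕ+ → ℝ}
    (hd : Tendsto d atTop atTop) (ha : OffDiagSmall m a d) {l : ℕ} (hl : l ∈ Finset.Icc 1 m) :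
    ∃ C : ℝ, 0 ≤ C ∧
      ∀ j : ℕ+, |ext (a l) ((j : ℤ) - l)| + |a l j| ≤ C * (1 + |d j|) := by
  have h1 := (ha l hl).eventually (gt_mem_nhds (zero_lt_one (α := ℝ)))
  have h2 := hd.eventually_ge_atTop 1
  obtain ⟨N, hN⟩ := eventually_atTop.1 (h1.and h2)
  set g : ℕ+ → ℝ := fun j => |ext (a l) ((j : ℤ) - l)| + |a l j| with hg
  have hg0 : ∀ j, 0 ≤ g j := fun j => by positivity
  have hS : 0 ≤ ∑ j ∈ Finset.Icc 1 N, g j := Finset.sum_nonneg fun j _ => hg0 j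
  refine ⟨1 + ∑ j ∈ Finset.Icc 1 N, g j, by linarith, fun j => ?_⟩
  change g j ≤ _
  have hdj := abs_nonneg (d j)
  rcases le_total N j with h | h
  · obtain ⟨h3, h4⟩ := hN j h
    have h5 : g j < 1 * d j := (div_lt_iff₀ (by linarith)).1 h3
    have h6 := le_abs_self (d j)
    nlinarith
  · have h3 : g j ≤ ∑ j ∈ Finset.Icc 1 N, g j :=
      Finset.single_le_sum (fun j _ => hg0 j) (Finset.mem_Icc.2 ⟨one_le, h⟩)
    nlinarith

/-- The off-diagonal part maps the domain of the diagonal operator into `ℓ²`. -/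
theorem memℓp_offDiagAction {m : ℕ} {a : ℕ → ℕ+ → ℝ} {d : ℕ+ → ℝ}
    (hd : Tendsto d atTop atTop) (ha : OffDiagSmall m a d) {x : Ell2} (hx : x ∈ diagDomain d) :
    Memℓp (offDiagAction m a x) 2 := by
  have two : (0 : ℝ) < (2 : ENNReal).toReal := by simp
  have hy : Memℓp (fun j : ℕ+ => ((1 + |d j| : ℝ) : ℂ) * x j) 2 := by
    have hx' : Memℓp (fun j => (d j : ℂ) * x j) 2 := hx
    have h1 : Memℓp (fun j => ((|d j| : ℝ) : ℂ) * x j) 2 := by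
      rw [memℓp_gen_iff two] at hx' ⊢
      simpa using hx'
    have h2 := Memℓp.add (lp.memℓp x) h1
    convert h2 using 1
    funext j
    simp [add_mul]
  rw [memℓp_gen_iff two] at hy
  have hY := summable_ext hy
  have key : ∀ (φ : ℕ+ → ℤ) (_ : Function.Injective φ) (c : ℕ+ → ℝ) (C : ℝ), 0 ≤ C →
      (∀ j k : ℕ+, (k : ℤ) = φ j → |c j| ≤ C * (1 + |d k|)) →
      Memℓp (fun j : ℕ+ => (c j : ℂ) * ext (x : ℕ+ → ℂ) (φ j)) 2 := by
    intro φ hφ c C hC hc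
    rw [memℓp_gen_iff two]
    refine Summable.of_nonneg_of_le (fun j => by positivity) (fun j => ?_)
      ((hY.comp_injective hφ).mul_left (C ^ (2 : ENNReal).toReal))
    rcases ext_cases (φ j) with h | ⟨k, hk⟩
    · simp [ext_of_nonpos _ h]
    · have hb := hc j k hk
      simp only [Function.comp, ← hk, ext_coe]
      rw [← Real.mul_rpow hC (norm_nonneg _)]
      refine Real.rpow_le_rpow (norm_nonneg _) ?_ two.le
      have h1 : (0 : ℝ) ≤ 1 + |d k| := by positivity
      rw [norm_mul, norm_mul, Complex.norm_real, Complex.norm_real, Real.norm_eq_abs,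
        Real.norm_eq_abs, abs_of_nonneg h1, ← mul_assoc]
      gcongr
  have hsum : offDiagAction m a x = ∑ l ∈ Finset.Icc 1 m, fun j : ℕ+ =>
      ((a l j : ℂ) * ext (x : ℕ+ → ℂ) ((j : ℤ) + l)
        + ((ext (a l) ((j : ℤ) - l) : ℝ) : ℂ) * ext (x : ℕ+ → ℂ) ((j : ℤ) - l)) := by
    funext j
    simp [offDiagAction, Finset.sum_apply]
  rw [hsum]
  refine Finset.sum_induction _ (fun f : ℕ+ → ℂ => Memℓp f 2)
    (fun f g hf hg => Memℓp.add hf hg) zero_memℓp (fun l hl => ?_)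
  obtain ⟨C, hC, hb⟩ := ha.bound hd hl
  have hcast : ∀ p q : ℕ+, (p : ℤ) = q → p = q := fun p q h =>
    PNat.coe_injective (by exact_mod_cast h)
  have h1 := key (fun j => (j : ℤ) + l) (fun p q h => hcast p q (by simpa using h))
    (a l) C hC (fun (j k : ℕ+) hk => by
      have := hb k
      rw [hk, add_sub_cancel_right, ext_coe] at this
      linarith [abs_nonneg (a l k)])
  have h2 := key (fun j => (j : ℤ) - l) (fun p q h => hcast p q (by simpa using h))
    (fun j => ext (a l) ((j : ℤ) - l)) C hC (fun (j k : ℕ+) hk => by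
      have := hb k
      rw [← hk, ext_coe]
      linarith [abs_nonneg (ext (a l) ((k : ℤ) - l))])
  exact Memℓp.add h1 h2

/-- The diagonal operator `D`. -/
def diagOp (d : ℕ+ → ℝ) : Ell2 →ₗ.[ℂ] Ell2 where
  domain := diagDomain d
  toFun :=
    { toFun := fun x => ⟨fun j => (d j : ℂ) * (x : Ell2) j, x.2⟩
      map_add' := fun x y => by
        ext j
        exact mul_add _ _ _
      map_smul' := fun c x => by
        ext j
        exact mul_left_comm _ _ _ }

theorem ext_add (x y : ℕ+ → ℂ) (j : ℤ) : ext (x + y) j = ext x j + ext y j := by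
  unfold ext; split_ifs <;> simp

theorem ext_smul (c : ℂ) (x : ℕ+ → ℂ) (j : ℤ) : ext (c • x) j = c * ext x j := by
  unfold ext; split_ifs <;> simp

/-- The off-diagonal operator `A'`, on the domain of `D`. -/
def offDiagOp (m : ℕ) (a : ℕ → ℕ+ → ℝ) (d : ℕ+ → ℝ)
    (hd : Tendsto d atTop atTop) (ha : OffDiagSmall m a d) : Ell2 →ₗ.[ℂ] Ell2 where
  domain := diagDomain d
  toFun :=
    { toFun := fun x => ⟨offDiagAction m a (x : Ell2), memℓp_offDiagAction hd ha x.2⟩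
      map_add' := fun x y => by
        ext j
        simp only [offDiagAction, Submodule.coe_add, lp.coeFn_add, Pi.add_apply, ext_add,
          ← Finset.sum_add_distrib]
        exact Finset.sum_congr rfl fun l _ => by ring
      map_smul' := fun c x => by
        ext j
        simp only [offDiagAction, Submodule.coe_smul, lp.coeFn_smul, Pi.smul_apply, ext_smul,
          RingHom.id_apply, smul_eq_mul, Finset.mul_sum]
        exact Finset.sum_congr rfl fun l _ => by ring }

/-- The band operator `A = D + A'`, on the domain of `D`. -/
def bandOp (m : ℕ) (a : ℕ → ℕ+ → ℝ) (d : ℕ+ → ℝ)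
    (hd : Tendsto d atTop atTop) (ha : OffDiagSmall m a d) : Ell2 →ₗ.[ℂ] Ell2 :=
  diagOp d + offDiagOp m a d hd ha

/-- `ev` is the increasing sequence of eigenvalues of `T`, repeated according to multiplicity:
it is nondecreasing, tends to infinity, and there is an orthonormal basis `(v n)` of `ℓ²` with
`T (v n) = ev n • v n`. For symmetric `T` there is at most one such sequence. -/
structure IsEigenvalueSequence (T : Ell2 →ₗ.[ℂ] Ell2) (ev : ℕ+ → ℝ) : Prop where
  mono : Monotone ev
  tendsto : Tendsto ev atTop atTop
  basis : ∃ v : HilbertBasis ℕ+ ℂ Ell2,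
    ∀ n, ∃ h : v n ∈ T.domain, T ⟨v n, h⟩ = (ev n : ℂ) • v n

open Classical in
/-- The `n`-th eigenvalue `λ_n(T)` in increasing order (`0` if there is no such sequence). -/
def eigenvalue (T : Ell2 →ₗ.[ℂ] Ell2) (n : ℕ+) : ℝ :=
  if h : ∃ ev, IsEigenvalueSequence T ev then h.choose n else 0

/-- A `C¹` cutoff function: `0 ≤ χ ≤ 1`, `χ = 1` on `[-1, 1]`, `χ = 0` off `[-2, 2]`, `|χ'| ≤ 2`. -/
structure IsCutoff (χ : ℝ → ℝ) : Prop where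
  contDiff : ContDiff ℝ 1 χ
  nonneg : ∀ s, 0 ≤ χ s
  le_one : ∀ s, χ s ≤ 1
  eq_one : ∀ s ∈ Set.Icc (-1 : ℝ) 1, χ s = 1
  eq_zero : ∀ s ∉ Set.Icc (-2 : ℝ) 2, χ s = 0
  abs_deriv_le : ∀ s, |deriv χ s| ≤ 2

/-- The coefficients `ã_{n,l} j = a_l j (1 - χ ((j - n) / t))` cut off near `n`. -/
def outerCoeff (χ : ℝ → ℝ) (a : ℕ → ℕ+ → ℝ) (n t : ℕ+) (l : ℕ) (j : ℕ+) : ℝ :=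
  a l j * (1 - χ (((j : ℝ) - (n : ℝ)) / (t : ℝ)))

theorem IsCutoff.offDiagSmall_outerCoeff {χ : ℝ → ℝ} (hχ : IsCutoff χ) {m : ℕ}
    {a : ℕ → ℕ+ → ℝ} {d : ℕ+ → ℝ} (ha : OffDiagSmall m a d) (n t : ℕ+) :
    OffDiagSmall m (outerCoeff χ a n t) d := by
  intro l hl
  have hle : ∀ j, |outerCoeff χ a n t l j| ≤ |a l j| := fun j => by
    have h0 := hχ.nonneg (((j : ℝ) - (n : ℝ)) / (t : ℝ))
    have h1 := hχ.le_one (((j : ℝ) - (n : ℝ)) / (t : ℝ))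
    rw [outerCoeff, abs_mul]
    refine mul_le_of_le_one_right (abs_nonneg _) ?_
    rw [abs_le]
    constructor <;> linarith
  have hle' : ∀ i : ℤ, |ext (outerCoeff χ a n t l) i| ≤ |ext (a l) i| := fun i => by
    unfold ext
    split_ifs
    · exact hle _
    · exact le_rfl
  refine squeeze_zero_norm (fun j => ?_) (by simpa using (ha l hl).norm)
  simp only [norm_div, Real.norm_eq_abs]
  refine div_le_div_of_nonneg_right ?_ (abs_nonneg _)
  have habs : ∀ x y : ℝ, |(|x| + |y|)| = |x| + |y| := fun x y =>
    abs_of_nonneg (add_nonneg (abs_nonneg x) (abs_nonneg y))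
  rw [habs, habs]
  exact add_le_add (hle' _) (hle _)

/-- `D + Ã_n`: the band operator with the off-diagonal entries removed near `n`,
where `t = τ_n`. -/
def outerOp (m : ℕ) (a : ℕ → ℕ+ → ℝ) (d : ℕ+ → ℝ)
    (hd : Tendsto d atTop atTop) (ha : OffDiagSmall m a d)
    (χ : ℝ → ℝ) (hχ : IsCutoff χ) (n t : ℕ+) : Ell2 →ₗ.[ℂ] Ell2 :=
  bandOp m (outerCoeff χ a n t) d hd (hχ.offDiagSmall_outerCoeff ha n t)

/-- `α_s j = max |a_l (j + i)|` over `1 ≤ l ≤ m`, `|i| ≤ s`. -/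
def alpha (m : ℕ) (a : ℕ → ℕ+ → ℝ) (s : ℕ) (j : ℤ) : ℝ :=
  ⨆ p : Finset.Icc 1 m × Finset.Icc (-(s : ℤ)) s, |ext (a p.1) (j + p.2)|

/-- `2 α_s j / t + max |(Δ a_l) (j + i)|` over `1 ≤ l ≤ m`, `|i| ≤ s`. -/
def alphaTilde (m : ℕ) (a : ℕ → ℕ+ → ℝ) (t : ℕ+) (s : ℕ) (j : ℤ) : ℝ :=
  2 * alpha m a s j / t +
    ⨆ p : Finset.Icc 1 m × Finset.Icc (-(s : ℤ)) s, |fdiff (ext (a p.1)) (j + p.2)|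

/-- `γ_s j = min (Δ d) (j + i)` over `|i| ≤ s + 1`. -/
def gamma (d : ℕ+ → ℝ) (s : ℕ) (j : ℤ) : ℝ :=
  ⨅ i : Finset.Icc (-((s : ℤ) + 1)) ((s : ℤ) + 1), fdiff (ext d) (j + i)

/-- `γ̃_s j = max |(Δ² d) (j + i)|` over `|i| ≤ s`. -/
def gammaTilde (d : ℕ+ → ℝ) (s : ℕ) (j : ℤ) : ℝ :=
  ⨆ i : Finset.Icc (-(s : ℤ)) s, |fdiff (fdiff (ext d)) (j + i)|

/-- `ρ_n j = 2 α̃_{n,4m} j (α_{4m} j / γ_{4m} j) + m γ̃_{5m} j (α_{4m} j)² / (γ_{4m} j)²`,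
where `t = τ_n`. -/
def rho (m : ℕ) (a : ℕ → ℕ+ → ℝ) (d : ℕ+ → ℝ) (t : ℕ+) (j : ℤ) : ℝ :=
  2 * alphaTilde m a t (4 * m) j * (alpha m a (4 * m) j / gamma d (4 * m) j) +
    m * gammaTilde d (5 * m) j * (alpha m a (4 * m) j ^ 2 / gamma d (4 * m) j ^ 2)

end BandMatrix

end

/-! Near the index n the off-diagonal part can be removed, up to a commutator error, by a unitary
conjugation. Let φ be the cutoff around n, let E be A' with its coefficients multiplied by φ, so
that A - E = D + Ã_n, and let B be the band matrix with entries e(j, j+s) / (d(j+s) - d(j)). Then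
[D, B] = -E. Since E is symmetric and the denominators change sign under transposition, B is
skew-symmetric and exp(tB) is unitary.

For v(t) = exp(tB)x the form F(t) = ⟨(A - (1-t)E) v(t), v(t)⟩ joins the form of D + Ã_n at x to the
form of A at exp(B)x. Its derivative is the form of E + [A - (1-t)E, B], and [D, B] = -E leaves only
[A' - (1-t)E, B]. The entries of this commutator are differences of products of slowly varying
sequences. A discrete product and quotient rule bounds each by m·sup ρ (`abs_commutator_le`), and
the (2m)² pairs of shifts give the norm bound 4m³·sup ρ (`abs_eigenvalue_sub_le`). By the min-max
comparison `IsEigenvalueSequence.le_add`, all eigenvalues of A and D + Ã_n with the same index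
differ by at most this much, and the n-th eigenvalue of D + Ã_n is d(n) by assumption.

D is unbounded, so the computation is carried out on vectors Gu with G = (D + c)⁻¹. The operators AG
and (D + c)BG are bounded, the latter because B has finitely many nonzero entries. The same G yields
the spectrum: A + c = (1 + A'G)(D + c) with ‖A'G‖ < 1, so A + c has a compact symmetric inverse
(`exists_isEigenvalueSequence`). -/

noncomputable section

namespace BandMatrix

open scoped InnerProductSpace

universe u

/-! ### Increasing enumeration and the spectral theorem for compact operators -/

/-- A function on an infinite type with finite sublevel sets can be listed increasingly. -/
theorem exists_monotone_enum {ι : Type*} [Infinite ι] (f : ι → ℝ)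
    (hf : ∀ M, {i | f i ≤ M}.Finite) : ∃ e : ℕ+ ≃ ι, Monotone (f ∘ e) := by
  classical
  have : Countable ι := by
    rw [← Set.countable_univ_iff]
    have : (Set.univ : Set ι) = ⋃ n : ℕ, {i | f i ≤ n} := by
      ext i
      simp only [Set.mem_univ, Set.mem_iUnion, true_iff]
      exact exists_nat_ge (f i)
    rw [this]
    exact Set.countable_iUnion fun n => (hf n).countable
  obtain ⟨g, hg⟩ := exists_injective_nat ι
  -- Ties of `f` are broken by an injection into ℕ. This gives a linear order with finite initial
  -- segments, hence one isomorphic to ℕ.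
  let key : ι → ℝ ×ₗ ℕ := fun i => toLex (f i, g i)
  have hkey : Function.Injective key := fun i j h => hg (congrArg (fun p => (ofLex p).2) h)
  let _ : LinearOrder ι := LinearOrder.lift' key hkey
  have hle : ∀ {i j : ι}, i ≤ j → f i ≤ f j := by
    intro i j h
    have h' : key i ≤ key j := h
    rw [Prod.Lex.le_iff] at h'
    rcases h' with h' | h'
    · exact le_of_lt h'
    · exact h'.1.le
  have hfin : ∀ j : ι, (Set.Iic j).Finite := fun j => (hf (f j)).subset fun i hi => hle hi
  let _ : LocallyFiniteOrder ι := LocallyFiniteOrder.ofFiniteIcc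
    fun a b => (hfin b).subset Set.Icc_subset_Iic_self
  obtain ⟨i₀⟩ : Nonempty ι := inferInstance
  obtain ⟨b, hb, hmin⟩ := (hfin i₀).exists_minimalFor id _ ⟨i₀, Set.mem_Iic.2 le_rfl⟩
  let _ : OrderBot ι :=
    { bot := b
      bot_le := fun j => by
        rcases le_total j i₀ with h | h
        · rcases le_total b j with h' | h'
          · exact h'
          · exact hmin h h'
        · exact le_trans hb h }
  have : NoMaxOrder ι := ⟨fun j => by
    by_contra! h
    exact Set.infinite_univ ((hfin j).subset fun i _ => h i)⟩
  let _ : SuccOrder ι := LinearLocallyFiniteOrder.succOrder ι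
  let _ : PredOrder ι := LinearLocallyFiniteOrder.predOrder ι
  let e : ι ≃o ℕ := orderIsoNatOfLinearSuccPredArch
  exact ⟨Equiv.pnatEquivNat.trans e.symm.toEquiv, fun p q h =>
    hle (e.symm.monotone (by simpa [Equiv.pnatEquivNat] using PNat.natPred_le_natPred.2 h))⟩

section

variable {H : Type*} [NormedAddCommGroup H] [InnerProductSpace ℂ H]

/-- Reindexing of a Hilbert basis. -/
theorem exists_hilbertBasis_reindex [CompleteSpace H] {ι κ : Type*} (b : HilbertBasis ι ℂ H)
    (e : κ ≃ ι) : ∃ v : HilbertBasis κ ℂ H, ∀ k, v k = b (e k) := by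
  have ho : Orthonormal ℂ (b ∘ e) := b.orthonormal.comp e e.injective
  have hs : ⊤ ≤ (Submodule.span ℂ (Set.range (b ∘ e))).topologicalClosure := by
    rw [e.surjective.range_comp, b.dense_span]
  exact ⟨HilbertBasis.mk ho hs, fun k => by rw [HilbertBasis.coe_mk]; rfl⟩

/-- The images of orthonormal eigenvectors with |μ| ≥ ε are at mutual distance at least ε, so
infinitely many of them cannot lie in a compact set. -/
theorem finite_setOf_le_abs_eigenvalue {R : H →L[ℂ] H} (hR : IsCompactOperator R)
    {ι : Type*} {v : ι → H} (hv : Orthonormal ℂ v) {μ : ι → ℝ} (hμ : ∀ i, R (v i) = (μ i : ℂ) • v i)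
    {ε : ℝ} (hε : 0 < ε) : {i | ε ≤ |μ i|}.Finite := by
  by_contra hinf
  have hinf : {i | ε ≤ |μ i|}.Infinite := hinf
  let s := hinf.natEmbedding
  obtain ⟨K, hK, hsub⟩ := hR.image_closedBall_subset_compact (𝕜₁ := ℂ) (f := (R : H →ₗ[ℂ] H)) 1
  have hmem : ∀ n, R (v (s n)) ∈ K := fun n => hsub ⟨v (s n), by simp [hv.1], rfl⟩
  obtain ⟨x, -, φ, hφ, hlim⟩ := hK.tendsto_subseq hmem
  have hc := hlim.cauchySeq
  rw [Metric.cauchySeq_iff] at hc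
  obtain ⟨N, hN⟩ := hc ε hε
  have h1 := hN N le_rfl (N + 1) (by omega)
  have hne : (s (φ N) : ι) ≠ s (φ (N + 1)) := fun h =>
    absurd (hφ.injective (s.injective (Subtype.ext h))) (by omega)
  have ho : ⟪R (v (s (φ N))), R (v (s (φ (N + 1))))⟫_ℂ = 0 := by
    rw [hμ, hμ, inner_smul_left, inner_smul_right, hv.2 hne]; simp
  have h2 : ‖R (v (s (φ N)))‖ ^ 2 ≤ ‖R (v (s (φ N))) - R (v (s (φ (N + 1))))‖ ^ 2 := by
    rw [@norm_sub_sq ℂ, ho]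
    simp
  have h3 : ε ≤ ‖R (v (s (φ N)))‖ := by
    rw [hμ, norm_smul, hv.1]
    have h5 : ε ≤ |μ (s (φ N))| := (s (φ N)).2
    simpa using h5
  rw [Function.comp_apply, Function.comp_apply, dist_eq_norm] at h1
  have h4 := abs_le_of_sq_le_sq h2 (norm_nonneg _)
  rw [abs_of_nonneg (norm_nonneg _)] at h4
  linarith

/-- Spectral theorem for compact symmetric operators. -/
theorem exists_hilbertBasis_eigenvectors {H : Type u} [NormedAddCommGroup H]
    [InnerProductSpace ℂ H] [CompleteSpace H] {R : H →L[ℂ] H}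
    (hR : IsCompactOperator R) (hs : (R : H →ₗ[ℂ] H).IsSymmetric) :
    ∃ (ι : Type u) (b : HilbertBasis ι ℂ H) (μ : ι → ℝ), ∀ i, R (b i) = (μ i : ℂ) • b i := by
  let E : ℂ → Submodule ℂ H := fun μ => Module.End.eigenspace (R : H →ₗ[ℂ] H) μ
  have hclosed : ∀ μ, IsClosed (E μ : Set H) := by
    intro μ
    have : (E μ : Set H) = {x | R x = μ • x} := by
      ext x
      exact Module.End.mem_eigenspace_iff
    rw [this]
    exact isClosed_eq R.continuous (continuous_const_smul μ)
  have hcomplete : ∀ μ, CompleteSpace (E μ) := fun μ => (hclosed μ).completeSpace_coe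
  -- The union of orthonormal bases of all eigenspaces, the kernel included, is orthonormal; it is
  -- total because the eigenspaces have trivial common orthogonal complement.
  choose w b hb using fun μ => exists_hilbertBasis ℂ (E μ)
  have hon : Orthonormal ℂ fun a : Σ μ, w μ => ((b a.1 a.2 : E a.1) : H) :=
    hs.orthogonalFamily_eigenspaces.orthonormal_sigma_orthonormal fun μ => (b μ).orthonormal
  have hspan : (Submodule.span ℂ
      (Set.range fun a : Σ μ, w μ => ((b a.1 a.2 : E a.1) : H)))ᗮ = ⊥ := by
    rw [eq_bot_iff, ← ContinuousLinearMap.orthogonalComplement_iSup_eigenspaces_eq_bot hR hs,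
      ← Submodule.iInf_orthogonal]
    intro x hx
    rw [Submodule.mem_iInf]
    intro μ
    rw [Submodule.mem_orthogonal']
    intro z hz
    have h1 := ((b μ).hasSum_repr ⟨z, hz⟩).mapL ((innerSL ℂ x).comp (E μ).subtypeL)
    refine h1.unique ?_
    convert hasSum_zero using 1
    funext i
    have h2 : ⟪x, ((b μ i : E μ) : H)⟫_ℂ = 0 :=
      Submodule.mem_orthogonal' _ _ |>.1 hx _ (Submodule.subset_span ⟨⟨μ, i⟩, rfl⟩)
    simp [h2]
  refine ⟨Σ μ, w μ, HilbertBasis.mkOfOrthogonalEqBot hon hspan, fun a => a.1.re, fun a => ?_⟩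
  rw [HilbertBasis.coe_mkOfOrthogonalEqBot]
  have h1 : R (b a.1 a.2 : E a.1) = a.1 • ((b a.1 a.2 : E a.1) : H) :=
    Module.End.mem_eigenspace_iff.1 (b a.1 a.2).2
  have hne : ((b a.1 a.2 : E a.1) : H) ≠ 0 := hon.ne_zero a
  have h2 := hs.conj_eigenvalue_eq_self (μ := a.1)
    (Module.End.hasEigenvalue_of_hasEigenvector ⟨(b a.1 a.2).2, hne⟩)
  have h3 : ((a.1.re : ℝ) : ℂ) = a.1 := Complex.conj_eq_iff_re.1 h2
  simp only [h3]
  exact h1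

/-! ### Quadratic forms and min-max comparison of eigenvalues -/

/-- Symmetry of a partially defined operator. -/
def IsSymm (T : H →ₗ.[ℂ] H) : Prop := ∀ x y : T.domain, ⟪T x, (y : H)⟫_ℂ = ⟪(x : H), T y⟫_ℂ

theorem hasSum_sq_norm_inner {ι : Type*} (v : HilbertBasis ι ℂ H) (y : H) :
    HasSum (fun i => ‖⟪v i, y⟫_ℂ‖ ^ 2) (‖y‖ ^ 2) := by
  have h := (v.hasSum_inner_mul_inner y y).mapL Complex.reCLM
  simp only [Complex.reCLM_apply] at h
  convert h using 1
  · funext i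
    rw [← inner_conj_symm y (v i), Complex.conj_mul']
    norm_cast
  · rw [inner_self_eq_norm_sq_to_K]
    norm_cast

/-- Parseval for ⟪T y, y⟫; symmetry moves T onto the basis vectors, so T need not be applied
termwise to an infinite expansion. -/
theorem hasSum_eigenvalue_mul {ι : Type*} {T : H →ₗ.[ℂ] H} (hT : IsSymm T)
    (v : HilbertBasis ι ℂ H) {ev : ι → ℝ}
    (hv : ∀ n, ∃ h : v n ∈ T.domain, T ⟨v n, h⟩ = (ev n : ℂ) • v n) (y : T.domain) :
    HasSum (fun i => ev i * ‖⟪v i, (y : H)⟫_ℂ‖ ^ 2) (⟪T y, (y : H)⟫_ℂ).re := by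
  have h := (v.hasSum_inner_mul_inner (T y) y).mapL Complex.reCLM
  simp only [Complex.reCLM_apply] at h
  convert h using 1
  funext i
  obtain ⟨hi, hTi⟩ := hv i
  have h1 := hT y ⟨v i, hi⟩
  simp only at h1
  rw [h1, hTi, inner_smul_right, mul_assoc, ← inner_conj_symm (y : H) (v i), Complex.conj_mul']
  norm_cast

end

/-- If the form of `T₁` along an isometry `U` of the domains is at most the form of `T₂` plus `K`,
then the eigenvalues of `T₁` exceed those of `T₂` by at most `K`. -/
theorem IsEigenvalueSequence.le_add {T₁ T₂ : Ell2 →ₗ.[ℂ] Ell2} (h₁ : IsSymm T₁) (h₂ : IsSymm T₂)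
    {ev₁ ev₂ : ℕ+ → ℝ} (e₁ : IsEigenvalueSequence T₁ ev₁) (e₂ : IsEigenvalueSequence T₂ ev₂)
    (U : T₂.domain →ₗ[ℂ] T₁.domain) (hU : ∀ x, ‖(U x : Ell2)‖ = ‖(x : Ell2)‖) {K : ℝ}
    (hK : ∀ x, (⟪T₁ (U x), (U x : Ell2)⟫_ℂ).re ≤ (⟪T₂ x, (x : Ell2)⟫_ℂ).re + K * ‖(x : Ell2)‖ ^ 2)
    (n : ℕ+) : ev₁ n ≤ ev₂ n + K := by
  obtain ⟨v₁, hv₁⟩ := e₁.basis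
  obtain ⟨v₂, hv₂⟩ := e₂.basis
  choose hd₂ hev₂ using hv₂
  let Φ : (Finset.Iic n → ℂ) →ₗ[ℂ] T₂.domain :=
    Fintype.linearCombination ℂ fun i : Finset.Iic n => (⟨v₂ i, hd₂ i⟩ : T₂.domain)
  have hΦ : ∀ c, (Φ c : Ell2) = ∑ i : Finset.Iic n, c i • v₂ i := fun c => by
    simp [Φ, Fintype.linearCombination_apply]
  -- There are n free coefficients and n - 1 orthogonality conditions, so some nonzero x in the span
  -- of the first n eigenvectors of `T₂` has U x orthogonal to the first n - 1 eigenvectors of `T₁`.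
  let Ψ : (Finset.Iic n → ℂ) →ₗ[ℂ] (Finset.Iio n → ℂ) := LinearMap.pi fun k =>
    (innerSL ℂ (v₁ k)).toLinearMap ∘ₗ T₁.domain.subtype ∘ₗ U ∘ₗ Φ
  have hker : LinearMap.ker Ψ ≠ ⊥ := by
    apply LinearMap.ker_ne_bot_of_finrank_lt
    simp only [Module.finrank_fintype_fun_eq_card, Fintype.card_coe]
    exact Finset.card_lt_card
      ⟨fun i hi => Finset.mem_Iic.2 (Finset.mem_Iio.1 hi).le,
        fun h => (Finset.mem_Iio.1 (h (Finset.mem_Iic.2 le_rfl))).false⟩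
  obtain ⟨c, hc, hc0⟩ := Submodule.exists_mem_ne_zero_of_ne_bot hker
  set x := Φ c with hx
  have hx0 : 0 < ‖(x : Ell2)‖ := by
    rw [norm_pos_iff]
    intro h
    rw [hx, hΦ] at h
    have hli : LinearIndependent ℂ fun i : Finset.Iic n => v₂ i :=
      v₂.orthonormal.linearIndependent.comp _ Subtype.val_injective
    exact hc0 (funext fun i => Fintype.linearIndependent_iff.1 hli c h i)
  have hlow : ∀ k < n, ⟪v₁ k, (U x : Ell2)⟫_ℂ = 0 := fun k hk =>
    congrFun (LinearMap.mem_ker.1 hc) ⟨k, Finset.mem_Iio.2 hk⟩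
  have hup : ∀ k, n < k → ⟪v₂ k, (x : Ell2)⟫_ℂ = 0 := fun k hk => by
    rw [hx, hΦ, inner_sum]
    refine Finset.sum_eq_zero fun i _ => ?_
    rw [inner_smul_right, v₂.orthonormal.2, mul_zero]
    rintro rfl
    exact absurd (Finset.mem_Iic.1 i.2) (not_le.2 hk)
  have b₁ : ev₁ n * ‖(U x : Ell2)‖ ^ 2 ≤ (⟪T₁ (U x), (U x : Ell2)⟫_ℂ).re := by
    refine hasSum_le (fun i => ?_) ((hasSum_sq_norm_inner v₁ (U x : Ell2)).mul_left _)
      (hasSum_eigenvalue_mul h₁ v₁ hv₁ (U x))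
    rcases lt_or_ge i n with h | h
    · simp [hlow i h]
    · exact mul_le_mul_of_nonneg_right (e₁.mono h) (by positivity)
  have b₂ : (⟪T₂ x, (x : Ell2)⟫_ℂ).re ≤ ev₂ n * ‖(x : Ell2)‖ ^ 2 := by
    refine hasSum_le (fun i => ?_) (hasSum_eigenvalue_mul h₂ v₂ (fun i => ⟨hd₂ i, hev₂ i⟩) x)
      ((hasSum_sq_norm_inner v₂ (x : Ell2)).mul_left _)
    rcases lt_or_ge n i with h | h
    · simp [hup i h]
    · exact mul_le_mul_of_nonneg_right (e₂.mono h) (by positivity)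
  have := hK x
  rw [hU] at b₁
  have hp : 0 < ‖(x : Ell2)‖ ^ 2 := by positivity
  nlinarith

/-! ### Weighted shifts on ℓ² -/

theorem pnat_cast_injective : Function.Injective (fun k : ℕ+ => (k : ℤ)) := fun p q h =>
  PNat.coe_injective (by exact_mod_cast (show (p : ℤ) = q from h))

theorem support_ext_subset {E : Type*} [Zero E] (f : ℕ+ → E) :
    Function.support (ext f) ⊆ Set.range fun k : ℕ+ => (k : ℤ) := fun j hj => by
  rcases ext_cases j with h | ⟨k, hk⟩
  · exact absurd (ext_of_nonpos f h) hj
  · exact ⟨k, hk⟩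

theorem tsum_ext {E : Type*} [AddCommMonoid E] [TopologicalSpace E] (f : ℕ+ → E) :
    ∑' j : ℤ, ext f j = ∑' j, f j := by
  rw [← pnat_cast_injective.tsum_eq (support_ext_subset f)]
  exact tsum_congr fun j => ext_coe f j

theorem ext_map {E F : Type*} [Zero E] [Zero F] (x : ℕ+ → E) (φ : E → F) (h0 : φ 0 = 0) (j : ℤ) :
    ext (fun i => φ (x i)) j = φ (ext x j) := by
  unfold ext
  split_ifs
  · rfl
  · exact h0.symm

theorem ell2_ext {x y : Ell2} (h : ∀ j, x j = y j) : x = y := lp.ext (funext h)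

theorem ell2_sum_apply {ι : Type*} (s : Finset ι) (f : ι → Ell2) (j : ℕ+) :
    (∑ i ∈ s, f i : Ell2) j = ∑ i ∈ s, (f i : Ell2) j := by
  rw [lp.coeFn_sum, Finset.sum_apply]

/-- The two weighted shifts with weights `c` and shifts `s`, `-s` are formally adjoint. -/
theorem inner_shift_eq {x y z z' : Ell2} {c : ℤ → ℝ} {s : ℤ}
    (hz : ∀ j : ℕ+, z j = (c j : ℂ) * ext (x : ℕ+ → ℂ) ((j : ℤ) + s))
    (hz' : ∀ j : ℕ+, z' j = (c ((j : ℤ) - s) : ℂ) * ext (y : ℕ+ → ℂ) ((j : ℤ) - s)) :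
    ⟪z, y⟫_ℂ = ⟪x, z'⟫_ℂ := by
  rw [lp.inner_eq_tsum, lp.inner_eq_tsum, ← tsum_ext, ← tsum_ext]
  -- Extended by zero to ℤ, the two sums are translates of each other by `s`, and no boundary terms
  -- appear.
  refine Eq.trans (tsum_congr fun i => ?_) ((Equiv.addRight s).tsum_eq _)
  simp only [Equiv.coe_addRight]
  have e1 : ∀ i : ℤ, ext (fun j => ⟪z j, y j⟫_ℂ) i =
      (c i : ℂ) * (starRingEnd ℂ) (ext (x : ℕ+ → ℂ) (i + s)) * ext (y : ℕ+ → ℂ) i := by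
    intro i
    rcases ext_cases i with h | ⟨k, rfl⟩
    · simp [ext_of_nonpos _ h]
    · rw [ext_coe, ext_coe, hz, RCLike.inner_apply, map_mul, Complex.conj_ofReal]
      ring
  have e2 : ∀ i : ℤ, ext (fun j => ⟪x j, z' j⟫_ℂ) i =
      (c (i - s) : ℂ) * (starRingEnd ℂ) (ext (x : ℕ+ → ℂ) i) * ext (y : ℕ+ → ℂ) (i - s) := by
    intro i
    rcases ext_cases i with h | ⟨k, rfl⟩
    · simp [ext_of_nonpos _ h]
    · rw [ext_coe, ext_coe, hz', RCLike.inner_apply]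
      ring
  rw [e1, e2, add_sub_cancel_right]

theorem shift_bound (x : Ell2) {c : ℤ → ℝ} {C : ℝ} (hC : 0 ≤ C) (hc : ∀ j : ℕ+, |c j| ≤ C)
    (s : ℤ) :
    Memℓp (fun j : ℕ+ => (c j : ℂ) * ext (x : ℕ+ → ℂ) ((j : ℤ) + s)) 2 ∧
      ∑' j : ℕ+, ‖(c j : ℂ) * ext (x : ℕ+ → ℂ) ((j : ℤ) + s)‖ ^ (2 : ENNReal).toReal
        ≤ (C * ‖x‖) ^ (2 : ENNReal).toReal := by
  have two : (0 : ℝ) < (2 : ENNReal).toReal := by simp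
  have hx := lp.memℓp x
  rw [memℓp_gen_iff two] at hx
  have hX := summable_ext hx
  have hinj : Function.Injective fun j : ℕ+ => (j : ℤ) + s :=
    (add_left_injective s).comp pnat_cast_injective
  have hpt : ∀ j : ℕ+, ‖(c j : ℂ) * ext (x : ℕ+ → ℂ) ((j : ℤ) + s)‖ ^ (2 : ENNReal).toReal ≤
      C ^ (2 : ENNReal).toReal *
        ext (fun i => ‖x i‖ ^ (2 : ENNReal).toReal) ((j : ℤ) + s) := by
    intro j
    rw [ext_map (x : ℕ+ → ℂ) (fun z => ‖z‖ ^ (2 : ENNReal).toReal)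
      (by simp), ← Real.mul_rpow hC (norm_nonneg _)]
    refine Real.rpow_le_rpow (norm_nonneg _) ?_ two.le
    rw [norm_mul, Complex.norm_real, Real.norm_eq_abs]
    gcongr
    exact hc j
  have hS := (hX.comp_injective hinj).mul_left (C ^ (2 : ENNReal).toReal)
  have hS' := Summable.of_nonneg_of_le (fun j => by positivity) hpt hS
  refine ⟨(memℓp_gen_iff two).2 hS', (hS'.tsum_le_tsum hpt hS).trans ?_⟩
  rw [tsum_mul_left, Real.mul_rpow hC (norm_nonneg _), lp.norm_rpow_eq_tsum two,
    ← tsum_ext fun i => ‖x i‖ ^ (2 : ENNReal).toReal]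
  refine mul_le_mul_of_nonneg_left ?_ (by positivity)
  refine tsum_comp_le_tsum_of_inj hX (fun j => ?_) hinj
  rw [ext_map (x : ℕ+ → ℂ) (fun z => ‖z‖ ^ (2 : ENNReal).toReal) (by simp)]
  positivity

/-- Boundedness of a real weight on the positive integers. -/
def IsBdd (c : ℤ → ℝ) : Prop := ∃ C : ℝ, ∀ j : ℕ+, |c j| ≤ C

open Classical in
/-- The weighted shift `(W x)(j) = c j x (j + s)`, for a bounded weight `c`. -/
def wshift (c : ℤ → ℝ) (s : ℤ) : Ell2 →L[ℂ] Ell2 :=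
  if h : IsBdd c then
    LinearMap.mkContinuous
      { toFun := fun x => ⟨_, (shift_bound x ((abs_nonneg _).trans (h.choose_spec 1))
          h.choose_spec s).1⟩
        map_add' := fun x y => by
          refine ell2_ext fun j => ?_
          simp only [lp.coeFn_add, Pi.add_apply, ext_add, mul_add]
        map_smul' := fun r x => by
          refine ell2_ext fun j => ?_
          simp only [lp.coeFn_smul, Pi.smul_apply, ext_smul, smul_eq_mul, RingHom.id_apply]
          ring }
      h.choose fun x => by
        have hC := (abs_nonneg _).trans (h.choose_spec 1)
        exact lp.norm_le_of_tsum_le (by simp) (by positivity)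
          (shift_bound x hC h.choose_spec s).2
  else 0

theorem wshift_apply {c : ℤ → ℝ} (h : IsBdd c) (s : ℤ) (x : Ell2) (j : ℕ+) :
    wshift c s x j = (c j : ℂ) * ext (x : ℕ+ → ℂ) ((j : ℤ) + s) := by
  rw [wshift, dif_pos h]
  rfl

theorem norm_le_of_shift {x z : Ell2} {c : ℤ → ℝ} {C : ℝ} (hC : 0 ≤ C)
    (hc : ∀ j : ℕ+, |c j| ≤ C) {s : ℤ}
    (hz : ∀ j : ℕ+, z j = (c j : ℂ) * ext (x : ℕ+ → ℂ) ((j : ℤ) + s)) : ‖z‖ ≤ C * ‖x‖ := by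
  refine lp.norm_le_of_tsum_le (by simp) (by positivity) ?_
  simp_rw [hz]
  exact (shift_bound x hC hc s).2

theorem norm_wshift_le {c : ℤ → ℝ} {C : ℝ} (hC : 0 ≤ C) (hc : ∀ j : ℕ+, |c j| ≤ C) (s : ℤ) :
    ‖wshift c s‖ ≤ C :=
  ContinuousLinearMap.opNorm_le_bound _ hC fun x =>
    norm_le_of_shift hC hc (wshift_apply ⟨C, hc⟩ s x)

/-- A sequence vanishing off a finite set of indices is bounded. -/
theorem isBdd_of_support {c : ℤ → ℝ} (N : ℤ) (h : ∀ j, N < j → c j = 0) : IsBdd c := by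
  refine ⟨∑ i ∈ Finset.Icc 0 N, |c i|, fun j => ?_⟩
  rcases lt_or_ge N (j : ℤ) with hj | hj
  · rw [h _ hj, abs_zero]
    positivity
  · exact Finset.single_le_sum (f := fun i => |c i|) (fun i _ => abs_nonneg _)
      (Finset.mem_Icc.2 ⟨by positivity, hj⟩)

theorem isCompactOperator_sum {ι : Type*} (s : Finset ι) (f : ι → Ell2 →L[ℂ] Ell2)
    (hf : ∀ i ∈ s, IsCompactOperator (f i)) : IsCompactOperator (∑ i ∈ s, f i : Ell2 →L[ℂ] Ell2) := by
  classical
  induction s using Finset.induction_on with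
  | empty => simpa using isCompactOperator_zero
  | insert i s hi ih =>
    rw [Finset.sum_insert hi]
    exact (hf _ (by simp)).add (ih fun k hk => hf k (by simp [hk]))

/-- A diagonal operator with entries tending to zero is compact. -/
theorem isCompactOperator_wshift_zero {c : ℤ → ℝ}
    (hc : Tendsto (fun j : ℕ+ => c j) atTop (𝓝 0)) : IsCompactOperator (wshift c 0) := by
  have hbig : ∀ ε > 0, ∃ N : ℕ+, ∀ j ≥ N, |c j| ≤ ε := fun ε hε => by
    have h := hc.abs.eventually (gt_mem_nhds (by simpa using hε : |(0 : ℝ)| < ε))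
    obtain ⟨N, hN⟩ := eventually_atTop.1 h
    exact ⟨N, fun j hj => (hN j hj).le⟩
  have hbdd : IsBdd c := by
    obtain ⟨N, hN⟩ := hbig 1 one_pos
    refine ⟨1 + ∑ j ∈ Finset.Icc 1 N, |c j|, fun j => ?_⟩
    have h0 : 0 ≤ ∑ j ∈ Finset.Icc 1 N, |c j| := Finset.sum_nonneg fun _ _ => abs_nonneg _
    rcases le_total N j with h | h
    · linarith [hN j h]
    · have := Finset.single_le_sum (f := fun i : ℕ+ => |c i|) (fun i _ => abs_nonneg _)
        (Finset.mem_Icc.2 ⟨one_le, h⟩)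
      linarith
  -- The truncations have finite rank and converge in operator norm, since the norm of the remaining
  -- tail is at most the supremum of its entries.
  let F : ℕ+ → Ell2 →L[ℂ] Ell2 := fun N =>
    wshift (fun j => if j ≤ (N : ℤ) then c j else 0) 0
  have hF : ∀ N, IsCompactOperator (F N) := by
    intro N
    have hN : IsBdd fun j => if j ≤ (N : ℤ) then c j else 0 :=
      isBdd_of_support N fun j hj => if_neg (not_le.2 hj)
    let P : ℕ+ → Ell2 →L[ℂ] Ell2 := fun k =>
      (ContinuousLinearMap.toSpanSingleton ℂ (lp.single 2 k ((c k : ℂ)) : Ell2)).comp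
        (innerSL ℂ (lp.single 2 k (1 : ℂ) : Ell2))
    have hP : ∀ k, IsCompactOperator (P k) := fun k =>
      (isCompactOperator_of_locallyCompactSpace_rng
        (ContinuousLinearMap.toSpanSingleton ℂ (lp.single 2 k (c k : ℂ) : Ell2))).comp_clm _
    have : F N = ∑ k ∈ Finset.Icc 1 N, P k := by
      ext x j
      rw [wshift_apply hN, sum_apply, ell2_sum_apply]
      have : ∀ k, P k x j = if k = j then (c k : ℂ) * x k else 0 := by
        intro k
        by_cases h : k = j
        · subst h
          simp [P, lp.inner_single_left, mul_comm]
        · simp [P, h, lp.single_apply, Ne.symm h]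
      simp_rw [this]
      rw [Finset.sum_ite_eq' (Finset.Icc 1 N) j fun k => (c k : ℂ) * x k, add_zero, ext_coe]
      simp only [Finset.mem_Icc, one_le, true_and]
      by_cases h : j ≤ N
      · rw [if_pos h, if_pos (by exact_mod_cast h)]
      · rw [if_neg h, if_neg (by exact_mod_cast h)]
        simp
    rw [this]
    exact isCompactOperator_sum _ _ fun k _ => hP k
  refine isCompactOperator_of_tendsto (F := F) (l := atTop) ?_ (Eventually.of_forall hF)
  rw [Metric.tendsto_atTop]
  intro ε hε
  obtain ⟨N, hN⟩ := hbig (ε / 2) (by positivity)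
  refine ⟨N, fun n hn => lt_of_le_of_lt ?_ (half_lt_self hε)⟩
  have hn' : IsBdd fun j => if j ≤ (n : ℤ) then c j else 0 :=
    isBdd_of_support n fun j hj => if_neg (not_le.2 hj)
  rw [dist_eq_norm]
  refine ContinuousLinearMap.opNorm_le_bound _ (by positivity) fun x => ?_
  refine norm_le_of_shift (c := fun j => (if j ≤ (n : ℤ) then c j else 0) - c j) (s := 0)
    (by positivity) (fun j => ?_) (fun j => ?_)
  · by_cases h : j ≤ n
    · rw [if_pos (by exact_mod_cast h)]
      simpa using (half_pos hε).le
    · rw [if_neg (by exact_mod_cast h), zero_sub, abs_neg]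
      exact hN j (hn.trans (not_le.1 h).le)
  · change (F n x - wshift c 0 x : Ell2) j = _
    rw [lp.coeFn_sub, Pi.sub_apply, wshift_apply hn', wshift_apply hbdd]
    push_cast
    ring

/-! ### Band matrices indexed by signed shifts -/

/-- The nonzero integers of absolute value at most `m`. -/
def shifts (m : ℕ) : Finset ℤ := (Finset.Icc (-(m : ℤ)) m).erase 0

theorem mem_shifts {m : ℕ} {s : ℤ} : s ∈ shifts m ↔ s.natAbs ∈ Finset.Icc 1 m := by
  simp only [shifts, Finset.mem_erase, Finset.mem_Icc]
  omega

theorem neg_mem_shifts {m : ℕ} {s : ℤ} : -s ∈ shifts m ↔ s ∈ shifts m := by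
  rw [mem_shifts, mem_shifts, Int.natAbs_neg]

theorem sum_shifts_neg {M : Type*} [AddCommMonoid M] (m : ℕ) (f : ℤ → M) :
    ∑ s ∈ shifts m, f (-s) = ∑ s ∈ shifts m, f s :=
  Finset.sum_nbij' (fun s => -s) (fun s => -s) (fun _ h => neg_mem_shifts.2 h)
    (fun _ h => neg_mem_shifts.2 h) (fun _ _ => neg_neg _) (fun _ _ => neg_neg _) fun _ _ => rfl

theorem sum_shifts {M : Type*} [AddCommMonoid M] (m : ℕ) (f : ℤ → M) :
    ∑ s ∈ shifts m, f s = ∑ l ∈ Finset.Icc 1 m, (f l + f (-(l : ℤ))) := by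
  rw [Finset.sum_add_distrib]
  have h : shifts m = (Finset.Icc 1 m).image (fun l : ℕ => (l : ℤ)) ∪
      (Finset.Icc 1 m).image (fun l : ℕ => -(l : ℤ)) := by
    ext s
    simp only [mem_shifts, Finset.mem_union, Finset.mem_image, Finset.mem_Icc]
    constructor
    · intro h
      rcases le_total 0 s with h0 | h0
      · exact Or.inl ⟨s.natAbs, h, by omega⟩
      · exact Or.inr ⟨s.natAbs, h, by omega⟩
    · rintro (⟨l, hl, rfl⟩ | ⟨l, hl, rfl⟩) <;> omega
  rw [h, Finset.sum_union, Finset.sum_image (fun x _ y _ h => by simpa using h),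
    Finset.sum_image (fun x _ y _ h => by simpa using h)]
  rw [Finset.disjoint_left]
  intro s h1 h2
  simp only [Finset.mem_image, Finset.mem_Icc] at h1 h2
  obtain ⟨l, hl, rfl⟩ := h1
  obtain ⟨k, hk, hkl⟩ := h2
  omega

theorem card_shifts (m : ℕ) : (shifts m).card = 2 * m := by
  rw [Finset.card_eq_sum_ones, sum_shifts]
  simp [mul_comm]

/-- The entry `(j, j + s)` of the off-diagonal part. -/
def bandCoeff (a : ℕ → ℕ+ → ℝ) (s j : ℤ) : ℝ := ext (a s.natAbs) (min j (j + s))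

theorem bandCoeff_of_nonpos (a : ℕ → ℕ+ → ℝ) {s j : ℤ} (h : j ≤ 0 ∨ j + s ≤ 0) :
    bandCoeff a s j = 0 := ext_of_nonpos _ (by omega)

/-- Symmetry of the matrix: the entries (j, j+s) and (j+s, j) depend only on |s| and the smaller
index. -/
theorem bandCoeff_neg (a : ℕ → ℕ+ → ℝ) (s j : ℤ) :
    bandCoeff a (-s) (j + s) = bandCoeff a s j := by
  rw [bandCoeff, bandCoeff, Int.natAbs_neg]
  congr 1
  omega

theorem bandCoeff_neg' (a : ℕ → ℕ+ → ℝ) (s j : ℤ) :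
    bandCoeff a s (j - s) = bandCoeff a (-s) j := by
  rw [← bandCoeff_neg a s (j - s), sub_add_cancel]

theorem offDiagAction_eq (m : ℕ) (a : ℕ → ℕ+ → ℝ) (x : ℕ+ → ℂ) (j : ℕ+) :
    offDiagAction m a x j = ∑ s ∈ shifts m, (bandCoeff a s j : ℂ) * ext x ((j : ℤ) + s) := by
  rw [sum_shifts, offDiagAction]
  refine Finset.sum_congr rfl fun l _ => ?_
  rw [bandCoeff, bandCoeff, min_eq_left (by omega), min_eq_right (by omega), ext_coe,
    Int.natAbs_neg, Int.natAbs_natCast, sub_eq_add_neg]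

section

variable {m : ℕ} {a : ℕ → ℕ+ → ℝ} {d : ℕ+ → ℝ}

theorem bandOp_domain (hd : Tendsto d atTop atTop) (ha : OffDiagSmall m a d) :
    (bandOp m a d hd ha).domain = diagDomain d := inf_idem _

theorem bandOp_apply (hd : Tendsto d atTop atTop) (ha : OffDiagSmall m a d)
    (x : (bandOp m a d hd ha).domain) (j : ℕ+) :
    bandOp m a d hd ha x j = (d j : ℂ) * (x : Ell2) j +
      ∑ s ∈ shifts m, (bandCoeff a s j : ℂ) * ext ((x : Ell2) : ℕ+ → ℂ) ((j : ℤ) + s) := by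
  rw [← offDiagAction_eq]
  rfl

/-! ### Inverting D + c and the discrete spectrum of the band operator -/

/-- The shift `c` makes `d + c` at least `1` and large compared with the coefficients. -/
structure Dominating (m : ℕ) (a : ℕ → ℕ+ → ℝ) (d : ℕ+ → ℝ) (c : ℝ) : Prop where
  one_le : ∀ j, 1 ≤ d j + c
  coeff_le : ∀ l ∈ Finset.Icc 1 m, ∀ j : ℕ+,
    |ext (a l) ((j : ℤ) - l)| + |a l j| ≤ 1 / (4 * m) * (d j + c)

/-- Far out the limit hypothesis suffices, and the finitely many remaining indices are handled by
adding a constant. Validity for every larger c is what later excludes negative eigenvalues of (A +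
c)⁻¹. -/
theorem exists_dominating (hm : 1 ≤ m) (hd : Tendsto d atTop atTop) (ha : OffDiagSmall m a d) :
    ∃ c₀, ∀ c ≥ c₀, Dominating m a d c := by
  have hm' : (0 : ℝ) < m := by exact_mod_cast hm
  set ε : ℝ := 1 / (4 * m) with hε
  have hε0 : 0 < ε := by positivity
  have h1 : ∀ᶠ j : ℕ+ in atTop, ∀ l ∈ Finset.Icc 1 m,
      (|ext (a l) ((j : ℤ) - l)| + |a l j|) / d j < ε :=
    (Finset.eventually_all _).2 fun l hl => (ha l hl).eventually (gt_mem_nhds hε0)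
  obtain ⟨N, hN⟩ := eventually_atTop.1 (h1.and (hd.eventually_ge_atTop 1))
  let g : ℕ → ℕ+ → ℝ := fun l j => |ext (a l) ((j : ℤ) - l)| + |a l j|
  have hg0 : ∀ l j, 0 ≤ g l j := fun l j => by positivity
  let S := ∑ l ∈ Finset.Icc 1 m, ∑ j ∈ Finset.Icc 1 N, g l j
  let Δ := ∑ j ∈ Finset.Icc 1 N, |d j|
  have hS : 0 ≤ S := Finset.sum_nonneg fun l _ => Finset.sum_nonneg fun j _ => hg0 l j
  have hΔ : 0 ≤ Δ := Finset.sum_nonneg fun j _ => abs_nonneg _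
  have hΔj : ∀ j ≤ N, -Δ ≤ d j := fun j hj => by
    have := Finset.single_le_sum (f := fun j : ℕ+ => |d j|) (fun i _ => abs_nonneg _)
      (Finset.mem_Icc.2 ⟨one_le, hj⟩)
    linarith [neg_abs_le (d j)]
  have hSe : 0 ≤ S / ε := by positivity
  -- On the initial segment 1 + Δ gives d + c ≥ 1, and S/ε gives ε(d + c) ≥ S, which exceeds each
  -- coefficient there.
  refine ⟨1 + Δ + S / ε, fun c hc => ⟨fun j => ?_, fun l hl j => ?_⟩⟩
  · rcases le_total j N with h | h
    · linarith [hΔj j h]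
    · linarith [(hN j h).2]
  · change g l j ≤ _
    rcases le_total j N with h | h
    · have h2 : g l j ≤ S :=
        (Finset.single_le_sum (f := g l) (fun i _ => hg0 l i)
          (Finset.mem_Icc.2 ⟨one_le, h⟩)).trans
        (Finset.single_le_sum (f := fun l => ∑ j ∈ Finset.Icc 1 N, g l j)
          (fun l _ => Finset.sum_nonneg fun i _ => hg0 l i) hl)
      have h3 : ε * (S / ε) = S := by field_simp
      have h4 : ε * (S / ε) ≤ ε * (d j + c) :=
        mul_le_mul_of_nonneg_left (by linarith [hΔj j h]) hε0.le
      linarith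
    · obtain ⟨h2, h3⟩ := hN j h
      have h4 : g l j < ε * d j := (div_lt_iff₀ (by linarith)).1 (h2 l hl)
      have h5 : ε * d j ≤ ε * (d j + c) := mul_le_mul_of_nonneg_left (by linarith) hε0.le
      linarith

/-- The sequence `1 / (d + c)`. -/
def invWeight (d : ℕ+ → ℝ) (c : ℝ) : ℤ → ℝ := ext fun j => (d j + c)⁻¹

/-- The operator `(D + c)⁻¹`. -/
def diagInv (d : ℕ+ → ℝ) (c : ℝ) : Ell2 →L[ℂ] Ell2 := wshift (invWeight d c) 0

/-- The operator `D + c` on the domain of `D`. -/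
def diagAdd (d : ℕ+ → ℝ) (c : ℝ) : diagDomain d →ₗ[ℂ] Ell2 :=
  let D : diagDomain d →ₗ[ℂ] Ell2 := (diagOp d).toFun
  D + (c : ℂ) • (diagDomain d).subtype

/-- The operator `A' (D + c)⁻¹`. -/
def relOffDiag (m : ℕ) (a : ℕ → ℕ+ → ℝ) (d : ℕ+ → ℝ) (c : ℝ) : Ell2 →L[ℂ] Ell2 :=
  ∑ s ∈ shifts m, wshift (fun j => bandCoeff a s j * invWeight d c (j + s)) s

theorem invWeight_coe (d : ℕ+ → ℝ) (c : ℝ) (j : ℕ+) : invWeight d c j = (d j + c)⁻¹ :=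
  ext_coe _ _

namespace Dominating

variable {c : ℝ}

theorem pos (h : Dominating m a d c) (j : ℕ+) : 0 < d j + c := zero_lt_one.trans_le (h.one_le j)

theorem isBdd_invWeight (h : Dominating m a d c) : IsBdd (invWeight d c) := by
  refine ⟨1, fun j => ?_⟩
  rw [invWeight_coe, abs_of_pos (inv_pos.2 (h.pos j))]
  exact inv_le_one_of_one_le₀ (h.one_le j)

theorem diagInv_apply (h : Dominating m a d c) (u : Ell2) (j : ℕ+) :
    diagInv d c u j = ((d j + c)⁻¹ : ℝ) * u j := by
  rw [diagInv, wshift_apply h.isBdd_invWeight, invWeight_coe, add_zero, ext_coe]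

theorem ext_diagInv (h : Dominating m a d c) (u : Ell2) (j : ℤ) :
    ext (diagInv d c u : ℕ+ → ℂ) j = (invWeight d c j : ℂ) * ext (u : ℕ+ → ℂ) j := by
  rcases ext_cases j with hj | ⟨k, rfl⟩
  · simp [ext_of_nonpos _ hj]
  · rw [ext_coe, ext_coe, invWeight_coe, h.diagInv_apply]

theorem mul_diagInv_apply (h : Dominating m a d c) (u : Ell2) (j : ℕ+) :
    (d j : ℂ) * diagInv d c u j = u j - c * diagInv d c u j := by
  have h1 : ((d j : ℂ) + c) ≠ 0 := by exact_mod_cast (h.pos j).ne'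
  rw [h.diagInv_apply]
  push_cast
  field_simp
  ring

theorem diagInv_injective (h : Dominating m a d c) : Function.Injective (diagInv d c) := by
  intro u v huv
  refine ell2_ext fun j => ?_
  have h1 := congrArg (fun z : Ell2 => z j) huv
  simp only [h.diagInv_apply] at h1
  have h2 : (((d j + c)⁻¹ : ℝ) : ℂ) ≠ 0 := by exact_mod_cast (inv_pos.2 (h.pos j)).ne'
  exact mul_left_cancel₀ h2 h1

theorem diagInv_mem (h : Dominating m a d c) (u : Ell2) : diagInv d c u ∈ diagDomain d := by
  have : (fun j => (d j : ℂ) * diagInv d c u j) =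
      ((u - (c : ℂ) • diagInv d c u : Ell2) : ℕ+ → ℂ) := by
    funext j
    rw [h.mul_diagInv_apply]
    rfl
  change Memℓp (fun j => (d j : ℂ) * diagInv d c u j) 2
  rw [this]
  exact lp.memℓp _

theorem diagInv_diagAdd (h : Dominating m a d c) (x : diagDomain d) :
    diagInv d c (diagAdd d c x) = x := by
  refine ell2_ext fun j => ?_
  rw [h.diagInv_apply]
  have h1 : ((d j : ℂ) + c) ≠ 0 := by exact_mod_cast (h.pos j).ne'
  change (((d j + c)⁻¹ : ℝ) : ℂ) * ((d j : ℂ) * (x : Ell2) j + (c : ℂ) * (x : Ell2) j) = _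
  push_cast
  field_simp

/-- In column k = j + s the entry is a_l(k - l) for s = l and a_l(k) for s = -l; these are the two
terms that `Dominating` controls by d(k) + c. -/
theorem abs_relCoeff_le (h : Dominating m a d c) {s : ℤ} (hs : s ∈ shifts m) (j : ℤ) :
    |bandCoeff a s j * invWeight d c (j + s)| ≤ 1 / (4 * m) := by
  have h0 : (0 : ℝ) ≤ 1 / (4 * m) := by positivity
  rcases ext_cases (j + s) with hj | ⟨k, hk⟩
  · rw [bandCoeff_of_nonpos a (Or.inr hj), zero_mul, abs_zero]
    exact h0
  · rw [← hk, invWeight_coe, abs_mul, abs_inv, abs_of_pos (h.pos k), ← div_eq_mul_inv,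
      div_le_iff₀ (h.pos k)]
    refine le_trans ?_ (h.coeff_le _ (mem_shifts.1 hs) k)
    rcases le_total 0 s with h1 | h1
    · have : min j (j + s) = (k : ℤ) - (s.natAbs : ℤ) := by omega
      rw [bandCoeff, this]
      exact le_add_of_nonneg_right (abs_nonneg _)
    · have : min j (j + s) = (k : ℤ) := by omega
      rw [bandCoeff, this, ext_coe]
      exact le_add_of_nonneg_left (abs_nonneg _)

theorem isBdd_relCoeff (h : Dominating m a d c) {s : ℤ} (hs : s ∈ shifts m) :
    IsBdd fun j => bandCoeff a s j * invWeight d c (j + s) :=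
  ⟨_, fun j => h.abs_relCoeff_le hs j⟩

/-- There are 2m shifts of norm at most 1/(4m), so the norm is at most 1/2 and 1 + A'(D + c)⁻¹ is
invertible. -/
theorem norm_relOffDiag_lt (h : Dominating m a d c) : ‖relOffDiag m a d c‖ < 1 := by
  have h1 : ‖relOffDiag m a d c‖ ≤ ∑ s ∈ shifts m, 1 / (4 * m : ℝ) :=
    norm_sum_le_of_le _ fun s hs =>
      norm_wshift_le (by positivity) (fun j => h.abs_relCoeff_le hs j) s
  refine h1.trans_lt ?_
  rw [Finset.sum_const, card_shifts, nsmul_eq_mul]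
  push_cast
  rcases eq_or_ne (m : ℝ) 0 with h0 | h0
  · simp [h0]
  · field_simp
    norm_num

theorem relOffDiag_apply (h : Dominating m a d c) (u : Ell2) (j : ℕ+) :
    relOffDiag m a d c u j = ∑ s ∈ shifts m,
      (bandCoeff a s j : ℂ) * ext (diagInv d c u : ℕ+ → ℂ) ((j : ℤ) + s) := by
  rw [relOffDiag, sum_apply, ell2_sum_apply]
  refine Finset.sum_congr rfl fun s hs => ?_
  rw [wshift_apply (h.isBdd_relCoeff hs), h.ext_diagInv]
  push_cast
  ring

theorem bandOp_diagInv (h : Dominating m a d c) (hd : Tendsto d atTop atTop)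
    (ha : OffDiagSmall m a d) (u : Ell2) (hu : diagInv d c u ∈ (bandOp m a d hd ha).domain) :
    bandOp m a d hd ha ⟨diagInv d c u, hu⟩ =
      u - (c : ℂ) • diagInv d c u + relOffDiag m a d c u := by
  refine ell2_ext fun j => ?_
  rw [bandOp_apply, ← h.relOffDiag_apply, h.mul_diagInv_apply]
  rfl

theorem inner_diagInv (h : Dominating m a d c) (u v : Ell2) :
    ⟪diagInv d c u, v⟫_ℂ = ⟪u, diagInv d c v⟫_ℂ :=
  inner_shift_eq (c := invWeight d c) (s := 0) (wshift_apply h.isBdd_invWeight 0 u) (by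
    intro j
    rw [diagInv, wshift_apply h.isBdd_invWeight]
    simp)

/-- Symmetry of A' on the range of (D + c)⁻¹; the terms for s and -s are adjoint to each other. -/
theorem inner_relOffDiag (h : Dominating m a d c) (u v : Ell2) :
    ⟪relOffDiag m a d c u, diagInv d c v⟫_ℂ = ⟪diagInv d c u, relOffDiag m a d c v⟫_ℂ := by
  have h1 : relOffDiag m a d c u = ∑ s ∈ shifts m,
      wshift (fun j => bandCoeff a s j * invWeight d c (j + s)) s u := by
    rw [relOffDiag, sum_apply]
  have h2 : relOffDiag m a d c v = ∑ s ∈ shifts m,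
      wshift (fun j => bandCoeff a (-s) j * invWeight d c (j + -s)) (-s) v := by
    rw [relOffDiag, sum_apply, ← sum_shifts_neg]
  rw [h1, h2, sum_inner, inner_sum]
  refine Finset.sum_congr rfl fun s hs => ?_
  refine inner_shift_eq (c := bandCoeff a s) (s := s) (fun j => ?_) fun j => ?_
  · rw [wshift_apply (h.isBdd_relCoeff hs), h.ext_diagInv]
    push_cast
    ring
  · rw [wshift_apply (h.isBdd_relCoeff (neg_mem_shifts.2 hs)), ← sub_eq_add_neg, h.ext_diagInv,
      bandCoeff_neg']
    push_cast
    ring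

end Dominating

/-- Every vector of the domain is (D + c)⁻¹u, which reduces the claim to identities between bounded
operators. -/
theorem isSymm_bandOp (hm : 1 ≤ m) (hd : Tendsto d atTop atTop) (ha : OffDiagSmall m a d) :
    IsSymm (bandOp m a d hd ha) := by
  obtain ⟨c, hc⟩ := exists_dominating hm hd ha
  have h := hc c le_rfl
  have key : ∀ x : (bandOp m a d hd ha).domain, ∃ u, ∃ hu, x = ⟨diagInv d c u, hu⟩ := by
    intro x
    have hx : (x : Ell2) ∈ diagDomain d := bandOp_domain hd ha ▸ x.2
    have h1 := h.diagInv_diagAdd ⟨x, hx⟩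
    exact ⟨diagAdd d c ⟨x, hx⟩, by rw [h1]; exact x.2, Subtype.ext h1.symm⟩
  intro x y
  obtain ⟨u, hu, rfl⟩ := key x
  obtain ⟨v, hv, rfl⟩ := key y
  rw [h.bandOp_diagInv, h.bandOp_diagInv]
  simp only [inner_add_left, inner_sub_left, inner_add_right, inner_sub_right, inner_smul_left,
    inner_smul_right, Complex.conj_ofReal, h.inner_relOffDiag, h.inner_diagInv u v]

theorem isCompactOperator_diagInv (hd : Tendsto d atTop atTop) (c : ℝ) :
    IsCompactOperator (diagInv d c) := by
  refine isCompactOperator_wshift_zero ?_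
  simp_rw [invWeight_coe]
  exact (tendsto_atTop_add_const_right _ c hd).inv_tendsto_atTop

theorem not_finiteDimensional_ell2 : ¬ FiniteDimensional ℂ Ell2 := by
  intro h
  have h1 : LinearIndependent ℂ fun j : ℕ+ => (lp.single 2 j (1 : ℂ) : Ell2) := by
    refine Orthonormal.linearIndependent ⟨fun j => by simp, fun i j hij => ?_⟩
    change ⟪(lp.single 2 i (1 : ℂ) : Ell2), lp.single 2 j (1 : ℂ)⟫_ℂ = 0
    rw [lp.inner_single_left]
    simp [lp.single_apply, hij]
  have := h1.finite
  exact not_finite ℕ+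

theorem exists_isEigenvalueSequence (hm : 1 ≤ m) (hd : Tendsto d atTop atTop)
    (ha : OffDiagSmall m a d) : ∃ ev, IsEigenvalueSequence (bandOp m a d hd ha) ev := by
  obtain ⟨c, hc⟩ := exists_dominating hm hd ha
  have h := hc c le_rfl
  set T := bandOp m a d hd ha with hT
  set G := diagInv d c with hG
  have hmem : ∀ u, G u ∈ T.domain := fun u => by
    rw [hT, bandOp_domain]
    exact h.diagInv_mem u
  obtain ⟨V, hV⟩ : IsUnit (1 + relOffDiag m a d c) := by
    have := isUnit_one_sub_of_norm_lt_one (x := -relOffDiag m a d c)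
      (by rw [norm_neg]; exact h.norm_relOffDiag_lt)
    rwa [sub_neg_eq_add] at this
  let I : Ell2 →L[ℂ] Ell2 := ↑V⁻¹
  have hI : ∀ u, I u + relOffDiag m a d c (I u) = u := fun u => by
    have h1 : (V : Ell2 →L[ℂ] Ell2) * ↑V⁻¹ = 1 := V.mul_inv
    rw [hV] at h1
    exact congrArg (fun f : Ell2 →L[ℂ] Ell2 => f u) h1
  -- This says (T + c) G I = 1, so `R` below is the inverse of T + c.
  have hTI : ∀ u, T ⟨G (I u), hmem _⟩ = u - (c : ℂ) • G (I u) := fun u => by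
    refine (h.bandOp_diagInv hd ha (I u) (hmem _)).trans ?_
    nth_rw 4 [← hI u]
    abel
  have hIinj : Function.Injective I := fun u v huv => by
    rw [← hI u, ← hI v, huv]
  let R : Ell2 →L[ℂ] Ell2 := G.comp I
  have hR : IsCompactOperator R := (isCompactOperator_diagInv hd c).comp_clm I
  have hs : (R : Ell2 →ₗ[ℂ] Ell2).IsSymmetric := fun u v => by
    have h1 : ⟪T ⟨G (I u), hmem _⟩, G (I v)⟫_ℂ = ⟪G (I u), T ⟨G (I v), hmem _⟩⟫_ℂ :=
      isSymm_bandOp hm hd ha ⟨G (I u), hmem _⟩ ⟨G (I v), hmem _⟩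
    rw [hTI, hTI, inner_sub_left, inner_sub_right, inner_smul_left, inner_smul_right,
      Complex.conj_ofReal, sub_left_inj] at h1
    exact h1.symm
  obtain ⟨ι, b, μ, hμ⟩ := exists_hilbertBasis_eigenvectors hR hs
  have hb0 : ∀ i, b i ≠ 0 := fun i => b.orthonormal.ne_zero i
  have hμ0 : ∀ i, μ i ≠ 0 := fun i h0 => by
    have h1 := hμ i
    rw [h0] at h1
    have h2 : R (b i) = R 0 := by rw [h1, map_zero]; simp
    exact hb0 i (hIinj (h.diagInv_injective h2))
  have hbmem : ∀ i, b i ∈ T.domain := fun i => by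
    have h1 := T.domain.smul_mem ((μ i : ℂ)⁻¹) (hmem (I (b i)))
    have h2 : G (I (b i)) = (μ i : ℂ) • b i := hμ i
    rwa [h2, inv_smul_smul₀ (by exact_mod_cast hμ0 i)] at h1
  have hTb : ∀ i, T ⟨b i, hbmem i⟩ = (((μ i)⁻¹ - c : ℝ) : ℂ) • b i := fun i => by
    have h2 : G (I (b i)) = (μ i : ℂ) • b i := hμ i
    have hne : (μ i : ℂ) ≠ 0 := by exact_mod_cast hμ0 i
    have h3 : (⟨b i, hbmem i⟩ : T.domain) = (μ i : ℂ)⁻¹ • ⟨G (I (b i)), hmem _⟩ := by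
      apply Subtype.ext
      change b i = (μ i : ℂ)⁻¹ • G (I (b i))
      rw [h2, inv_smul_smul₀ hne]
    rw [h3, LinearPMap.map_smul, hTI, h2, smul_sub, smul_smul, smul_smul, ← sub_smul]
    congr 1
    push_cast
    field_simp
  -- If μ < 0, then c' = c - 1/μ ≥ c is dominating too and -c' is an eigenvalue of T. But T + c' =
  -- (1 + K)(D + c') with ‖K‖ < 1 is injective.
  have hμpos : ∀ i, 0 < μ i := fun i => by
    by_contra hneg
    have hneg : μ i < 0 := lt_of_le_of_ne (not_lt.1 hneg) (hμ0 i)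
    have hc' : c ≤ c - (μ i)⁻¹ := by linarith [inv_lt_zero.2 hneg]
    have h' := hc _ hc'
    have hx : b i ∈ diagDomain d := bandOp_domain hd ha ▸ hbmem i
    set u := diagAdd d (c - (μ i)⁻¹) ⟨b i, hx⟩ with hu
    have h1 : diagInv d (c - (μ i)⁻¹) u = b i := h'.diagInv_diagAdd ⟨b i, hx⟩
    have h2 : T ⟨diagInv d (c - (μ i)⁻¹) u, h1 ▸ hbmem i⟩ = _ := h'.bandOp_diagInv hd ha u _
    have h3 : (⟨diagInv d (c - (μ i)⁻¹) u, h1 ▸ hbmem i⟩ : T.domain) = ⟨b i, hbmem i⟩ :=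
      Subtype.ext h1
    rw [h3, hTb, h1] at h2
    have h4 : u = -relOffDiag m a d (c - (μ i)⁻¹) u := by
      rw [eq_neg_iff_add_eq_zero]
      have h5 : (((μ i)⁻¹ - c : ℝ) : ℂ) • b i = -(((c - (μ i)⁻¹ : ℝ) : ℂ) • b i) := by
        rw [← neg_smul]
        congr 1
        push_cast
        ring
      rw [h5] at h2
      have h6 : u + relOffDiag m a d (c - (μ i)⁻¹) u =
        (u - ((c - (μ i)⁻¹ : ℝ) : ℂ) • b i + relOffDiag m a d (c - (μ i)⁻¹) u) +
          ((c - (μ i)⁻¹ : ℝ) : ℂ) • b i := by abel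
      rw [h6, ← h2, neg_add_cancel]
    have h7 : ‖u‖ ≤ ‖relOffDiag m a d (c - (μ i)⁻¹)‖ * ‖u‖ := by
      conv_lhs => rw [h4, norm_neg]
      exact ContinuousLinearMap.le_opNorm _ _
    have h8 := h'.norm_relOffDiag_lt
    have h9 : ‖u‖ = 0 := by nlinarith [norm_nonneg u]
    rw [norm_eq_zero] at h9
    exact hb0 i (by rw [← h1, h9, map_zero])
  -- The bound 1/μ - c ≤ M forces μ ≥ 1/(|M + c| + 1), which compactness allows only finitely often.
  have hfin : ∀ M, {i | (μ i)⁻¹ - c ≤ M}.Finite := fun M => by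
    have hp : 0 < |M + c| + 1 := by positivity
    refine (finite_setOf_le_abs_eigenvalue hR b.orthonormal hμ (inv_pos.2 hp)).subset
      fun i hi => ?_
    have hi' : (μ i)⁻¹ - c ≤ M := hi
    rw [Set.mem_ofPred_eq, abs_of_pos (hμpos i)]
    exact inv_le_of_inv_le₀ (hμpos i) (by linarith [le_abs_self (M + c)])
  have hinf : Infinite ι := by
    by_contra hfi
    rw [not_infinite_iff_finite] at hfi
    have := Fintype.ofFinite ι
    exact not_finiteDimensional_ell2 b.toOrthonormalBasis.toBasis.finiteDimensional_of_finite
  obtain ⟨e, he⟩ := exists_monotone_enum (fun i => (μ i)⁻¹ - c) hfin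
  obtain ⟨v, hv⟩ := exists_hilbertBasis_reindex b e
  refine ⟨fun n => (μ (e n))⁻¹ - c, he, ?_, v, fun n => ?_⟩
  · refine tendsto_atTop_atTop_of_monotone he fun M => ?_
    by_contra! hM
    have : (Set.univ : Set ℕ+) ⊆ e ⁻¹' {i | (μ i)⁻¹ - c ≤ M} := fun n _ => (hM n).le
    exact Set.infinite_univ (((hfin M).preimage e.injective.injOn).subset this)
  · rw [hv n]
    exact ⟨hbmem _, hTb _⟩

/-- The comparison results hold for any eigenvalue sequences, so the choice made in `eigenvalue` is
harmless and uniqueness is never needed. -/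
theorem isEigenvalueSequence_eigenvalue {T : Ell2 →ₗ.[ℂ] Ell2}
    (h : ∃ ev, IsEigenvalueSequence T ev) : IsEigenvalueSequence T (eigenvalue T) := by
  have : eigenvalue T = h.choose := by
    funext n
    rw [eigenvalue, dif_pos h]
  rw [this]
  exact h.choose_spec

end

/-! ### The unitary flow of a skew-symmetric operator -/

section

variable {H : Type*} [NormedAddCommGroup H] [InnerProductSpace ℂ H] [CompleteSpace H]

theorem hasDerivAt_exp_apply (L B : H →L[ℂ] H) (u : H) (t : ℝ) :
    HasDerivAt (fun t : ℝ => L (NormedSpace.exp (t • B) u)) (L (B (NormedSpace.exp (t • B) u))) t := by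
  have h := hasDerivAt_exp_smul_const' B t
  exact ((L.restrictScalars ℝ).comp
    ((ContinuousLinearMap.apply ℂ H u).restrictScalars ℝ)).hasFDerivAt.comp_hasDerivAt t h

/-- The norm of `G u` is constant along the flow of `B'` if `G` intertwines `B'` with a
skew-symmetric operator. -/
theorem norm_exp_flow {G B B' : H →L[ℂ] H} (hG : ∀ u, G (B' u) = B (G u))
    (hB : ∀ x y, ⟪B x, y⟫_ℂ = -⟪x, B y⟫_ℂ) (u : H) (t : ℝ) :
    ‖G (NormedSpace.exp (t • B') u)‖ = ‖G u‖ := by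
  have hd : ∀ t : ℝ, HasDerivAt (fun t : ℝ => ⟪G (NormedSpace.exp (t • B') u),
      G (NormedSpace.exp (t • B') u)⟫_ℂ) 0 t := fun t => by
    refine ((hasDerivAt_exp_apply G B' u t).inner ℂ (hasDerivAt_exp_apply G B' u t)).congr_deriv ?_
    rw [hG, hB, add_neg_cancel]
  have h := is_const_of_deriv_eq_zero (fun t => (hd t).differentiableAt) (fun t => (hd t).deriv) t 0
  simp only [zero_smul, NormedSpace.exp_zero, one_apply_eq_self,
    inner_self_eq_norm_sq_to_K] at h
  have h' : ‖G (NormedSpace.exp (t • B') u)‖ ^ 2 = ‖G u‖ ^ 2 := by exact_mod_cast h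
  exact (pow_left_inj₀ (norm_nonneg _) (norm_nonneg _) two_ne_zero).1 h'

theorem norm_exp_intertwined {G B B' : H →L[ℂ] H} (hG : ∀ u, G (B' u) = B (G u))
    (hB : ∀ x y, ⟪B x, y⟫_ℂ = -⟪x, B y⟫_ℂ) (u : H) : ‖G (NormedSpace.exp B' u)‖ = ‖G u‖ := by
  simpa using norm_exp_flow hG hB u 1

theorem exp_exp_neg_apply (B : H →L[ℂ] H) (u : H) :
    NormedSpace.exp B (NormedSpace.exp (-B) u) = u := by
  let _ : NormedAlgebra ℚ (H →L[ℂ] H) := NormedAlgebra.restrictScalars ℚ ℂ _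
  have h1 : NormedSpace.exp B * NormedSpace.exp (-B) = 1 := by
    rw [← NormedSpace.exp_add_of_commute (Commute.neg_right (Commute.refl B)), add_neg_cancel,
      NormedSpace.exp_zero]
  exact congrArg (fun f : H →L[ℂ] H => f u) h1

/-- Comparison of the forms of `P` and `P - E G` along the flow of `B'`. -/
theorem abs_form_exp_sub_le {P G E B B' : H →L[ℂ] H} (hG : ∀ u, G (B' u) = B (G u))
    (hB : ∀ x y, ⟪B x, y⟫_ℂ = -⟪x, B y⟫_ℂ) {C : ℝ}
    (hC : ∀ r ∈ Set.Icc (0 : ℝ) 1, ∀ u, ‖E (G u) + (P (B' u) - (r : ℂ) • E (G (B' u)))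
      - B (P u - (r : ℂ) • E (G u))‖ ≤ C * ‖G u‖) (u : H) :
    |(⟪P (NormedSpace.exp B' u), G (NormedSpace.exp B' u)⟫_ℂ).re - (⟪P u - E (G u), G u⟫_ℂ).re|
      ≤ C * ‖G u‖ ^ 2 := by
  set v : ℝ → H := fun t => NormedSpace.exp (t • B') u with hv
  -- With P = AG this is the form of A - (1 - t)E at G v(t): at t = 0 it belongs to A - E, at t = 1
  -- to A. The mean value inequality on [0, 1] then needs only a bound for `F'`, used with r = 1 -
  -- t.
  let F : ℝ → ℂ := fun t => ⟪P (v t), G (v t)⟫_ℂ - ((1 - t : ℝ) : ℂ) * ⟪(E.comp G) (v t), G (v t)⟫_ℂ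
  let F' : ℝ → ℂ := fun t => ⟪E (G (v t)) + (P (B' (v t)) - ((1 - t : ℝ) : ℂ) • E (G (B' (v t))))
      - B (P (v t) - ((1 - t : ℝ) : ℂ) • E (G (v t))), G (v t)⟫_ℂ
  have hF : ∀ t, HasDerivAt F (F' t) t := fun t => by
    have h1 := (hasDerivAt_exp_apply P B' u t).inner ℂ (hasDerivAt_exp_apply G B' u t)
    have h2 := (hasDerivAt_exp_apply (E.comp G) B' u t).inner ℂ (hasDerivAt_exp_apply G B' u t)
    have h3 : HasDerivAt (fun t : ℝ => ((1 - t : ℝ) : ℂ)) ((-1 : ℝ) : ℂ) t :=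
      ((hasDerivAt_id t).const_sub 1).ofReal_comp
    refine (h1.sub (h3.mul h2)).congr_deriv ?_
    simp only [F', inner_add_left, inner_sub_left, hB, inner_smul_left, Complex.conj_ofReal, hG,
      ContinuousLinearMap.comp_apply, hv]
    push_cast
    ring
  have hbound : ∀ t ∈ Set.Ico (0 : ℝ) 1, ‖F' t‖ ≤ C * ‖G u‖ ^ 2 := fun t ht => by
    have h1 := hC (1 - t) ⟨by linarith [ht.2], by linarith [ht.1]⟩ (v t)
    have h2 : ‖G (v t)‖ = ‖G u‖ := norm_exp_flow hG hB u t
    refine (norm_inner_le_norm _ _).trans ?_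
    rw [h2] at h1 ⊢
    rw [pow_two, ← mul_assoc]
    exact mul_le_mul_of_nonneg_right h1 (norm_nonneg _)
  have h := norm_image_sub_le_of_norm_deriv_le_segment_01'
    (fun t _ => (hF t).hasDerivWithinAt) hbound
  have h1 : F 1 = ⟪P (NormedSpace.exp B' u), G (NormedSpace.exp B' u)⟫_ℂ := by simp [F, hv]
  have h0 : F 0 = ⟪P u - E (G u), G u⟫_ℂ := by simp [F, hv]
  rw [h1, h0] at h
  exact (Complex.sub_re _ _ ▸ Complex.abs_re_le_norm _).trans h

end

/-! ### Comparison of two band operators through a skew-symmetric band matrix -/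

/-- The bounded operator with entries `b s j` at `(j, j + s)`. -/
def bandCLM (m : ℕ) (b : ℤ → ℤ → ℝ) : Ell2 →L[ℂ] Ell2 := ∑ s ∈ shifts m, wshift (b s) s

theorem bandCLM_apply {m : ℕ} {b : ℤ → ℤ → ℝ} (hb : ∀ s, IsBdd (b s)) (x : Ell2) (j : ℕ+) :
    bandCLM m b x j = ∑ s ∈ shifts m, (b s j : ℂ) * ext (x : ℕ+ → ℂ) ((j : ℤ) + s) := by
  rw [bandCLM, sum_apply, ell2_sum_apply]
  exact Finset.sum_congr rfl fun s _ => wshift_apply (hb s) s x j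

theorem ext_bandCLM {m : ℕ} {b : ℤ → ℤ → ℝ} (hb : ∀ s, IsBdd (b s)) (hb0 : ∀ s, ∀ j ≤ 0, b s j = 0)
    (x : Ell2) (j : ℤ) :
    ext (bandCLM m b x : ℕ+ → ℂ) j =
      ∑ s ∈ shifts m, (b s j : ℂ) * ext (x : ℕ+ → ℂ) (j + s) := by
  rcases ext_cases j with h | ⟨k, rfl⟩
  · rw [ext_of_nonpos _ h]
    exact (Finset.sum_eq_zero fun s _ => by simp [hb0 s j h]).symm
  · rw [ext_coe, bandCLM_apply hb]

theorem inner_bandCLM_of_skew {m : ℕ} {b : ℤ → ℤ → ℝ} (hb : ∀ s, IsBdd (b s))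
    (hskew : ∀ s j, b (-s) (j + s) = -b s j) (x y : Ell2) :
    ⟪bandCLM m b x, y⟫_ℂ = -⟪x, bandCLM m b y⟫_ℂ := by
  have h2 : bandCLM m b y = ∑ s ∈ shifts m, wshift (b (-s)) (-s) y := by
    rw [bandCLM, sum_apply, ← sum_shifts_neg]
  rw [h2, bandCLM, sum_apply, sum_inner, inner_sum, ← Finset.sum_neg_distrib]
  refine Finset.sum_congr rfl fun s _ => ?_
  rw [← inner_neg_right]
  refine inner_shift_eq (wshift_apply (hb s) s x) fun j => ?_
  rw [lp.coeFn_neg, Pi.neg_apply, wshift_apply (hb _), ← sub_eq_add_neg]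
  have := hskew s (j - s)
  rw [sub_add_cancel] at this
  rw [this]
  push_cast
  ring

/-- Norm bound for a finite sum of weighted shifts with bounded coefficients. -/
theorem norm_le_of_double_shift {m : ℕ} {κ : ℤ → ℤ → ℤ → ℝ} {C : ℝ} (hC : 0 ≤ C)
    (hκ : ∀ s ∈ shifts m, ∀ k ∈ shifts m, ∀ j : ℕ+, |κ s k j| ≤ C) {y z : Ell2}
    (hz : ∀ j : ℕ+, z j = ∑ s ∈ shifts m, ∑ k ∈ shifts m,
      (κ s k j : ℂ) * ext (y : ℕ+ → ℂ) ((j : ℤ) + (s + k))) :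
    ‖z‖ ≤ 4 * (m : ℝ) ^ 2 * C * ‖y‖ := by
  have h : z = ∑ s ∈ shifts m, ∑ k ∈ shifts m, wshift (κ s k) (s + k) y := by
    refine ell2_ext fun j => ?_
    rw [hz, ell2_sum_apply]
    refine Finset.sum_congr rfl fun s hs => ?_
    rw [ell2_sum_apply]
    exact Finset.sum_congr rfl fun k hk => (wshift_apply ⟨C, hκ s hs k hk⟩ _ _ _).symm
  rw [h]
  have h1 : ∀ s ∈ shifts m, ‖∑ k ∈ shifts m, wshift (κ s k) (s + k) y‖ ≤
      ∑ k ∈ shifts m, C * ‖y‖ := fun s hs => norm_sum_le_of_le _ fun k hk =>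
    norm_le_of_shift hC (hκ s hs k hk) (wshift_apply ⟨C, hκ s hs k hk⟩ _ _)
  refine (norm_sum_le_of_le _ h1).trans (le_of_eq ?_)
  simp only [Finset.sum_const, card_shifts, nsmul_eq_mul]
  push_cast
  ring

section

variable {m : ℕ} {a a' : ℕ → ℕ+ → ℝ} {d : ℕ+ → ℝ}

/-- By `hbe`, E + [D, B] = 0, so E + [D + f, B] = [f, B]: the diagonal terms cancel and only
products of two off-diagonal entries survive. -/
theorem sum_commutator_eq {S : Finset ℤ} {D Y : ℤ → ℂ} {b e f : ℤ → ℤ → ℂ} {j : ℤ}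
    (hbe : ∀ s, e s j = b s j * (D (j + s) - D j)) :
    ∑ k ∈ S, e k j * Y (j + k) + (D j * ∑ k ∈ S, b k j * Y (j + k) +
        ∑ s ∈ S, f s j * ∑ k ∈ S, b k (j + s) * Y (j + s + k)) -
      ∑ k ∈ S, b k j * (D (j + k) * Y (j + k) + ∑ s ∈ S, f s (j + k) * Y (j + k + s)) =
    ∑ s ∈ S, ∑ k ∈ S, (f s j * b k (j + s) - b k j * f s (j + k)) * Y (j + (s + k)) := by
  have h1 : ∑ k ∈ S, b k j * (D (j + k) * Y (j + k) + ∑ s ∈ S, f s (j + k) * Y (j + k + s)) =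
      ∑ k ∈ S, b k j * D (j + k) * Y (j + k) +
        ∑ s ∈ S, ∑ k ∈ S, b k j * f s (j + k) * Y (j + (s + k)) := by
    rw [Finset.sum_comm (s := S) (t := S), ← Finset.sum_add_distrib]
    refine Finset.sum_congr rfl fun k _ => ?_
    rw [mul_add, Finset.mul_sum, mul_assoc]
    congr 1
    refine Finset.sum_congr rfl fun s _ => ?_
    rw [show j + k + s = j + (s + k) by ring]
    ring
  have h2 : ∑ s ∈ S, f s j * ∑ k ∈ S, b k (j + s) * Y (j + s + k) =
      ∑ s ∈ S, ∑ k ∈ S, f s j * b k (j + s) * Y (j + (s + k)) := by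
    refine Finset.sum_congr rfl fun s _ => ?_
    rw [Finset.mul_sum]
    refine Finset.sum_congr rfl fun k _ => ?_
    rw [add_assoc, mul_assoc]
  have h3 : ∑ k ∈ S, e k j * Y (j + k) =
      ∑ k ∈ S, b k j * D (j + k) * Y (j + k) - D j * ∑ k ∈ S, b k j * Y (j + k) := by
    rw [Finset.mul_sum, ← Finset.sum_sub_distrib]
    refine Finset.sum_congr rfl fun k _ => ?_
    rw [hbe]
    ring
  have h4 : ∑ s ∈ S, ∑ k ∈ S, (f s j * b k (j + s) - b k j * f s (j + k)) * Y (j + (s + k)) =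
      ∑ s ∈ S, ∑ k ∈ S, f s j * b k (j + s) * Y (j + (s + k)) -
        ∑ s ∈ S, ∑ k ∈ S, b k j * f s (j + k) * Y (j + (s + k)) := by
    rw [← Finset.sum_sub_distrib]
    refine Finset.sum_congr rfl fun s _ => ?_
    rw [← Finset.sum_sub_distrib]
    exact Finset.sum_congr rfl fun k _ => sub_mul _ _ _
  rw [h1, h2, h3, h4]
  ring

/-- Eigenvalues of two band operators whose coefficients differ by `e`, where
`e = -[D, B]` for the skew-symmetric band matrix `B` with entries `b`, in terms of a bound for
the commutators of the interpolated off-diagonal parts with `B`. -/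
theorem abs_eigenvalue_sub_le (hm : 1 ≤ m) (hd : Tendsto d atTop atTop) (ha : OffDiagSmall m a d)
    (ha' : OffDiagSmall m a' d) {e b : ℤ → ℤ → ℝ}
    (hae : ∀ s ∈ shifts m, ∀ j, bandCoeff a s j = bandCoeff a' s j + e s j)
    (he0 : ∀ s, ∀ j ≤ 0, e s j = 0)
    (hb0 : ∀ s j, (j ≤ 0 ∨ j + s ≤ 0) → b s j = 0)
    (hbe : ∀ s j, e s j = b s j * (ext d (j + s) - ext d j))
    (hskew : ∀ s j, b (-s) (j + s) = -b s j)
    {N : ℤ} (hN : ∀ s j, N < j → b s j = 0) {C : ℝ} (hC0 : 0 ≤ C)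
    (hC : ∀ r ∈ Set.Icc (0 : ℝ) 1, ∀ s ∈ shifts m, ∀ k ∈ shifts m, ∀ j : ℕ+,
      |(bandCoeff a s j - r * e s j) * b k ((j : ℤ) + s) -
        b k j * (bandCoeff a s ((j : ℤ) + k) - r * e s ((j : ℤ) + k))| ≤ C)
    {ev ev' : ℕ+ → ℝ} (hev : IsEigenvalueSequence (bandOp m a d hd ha) ev)
    (hev' : IsEigenvalueSequence (bandOp m a' d hd ha') ev') (n : ℕ+) :
    |ev n - ev' n| ≤ 4 * (m : ℝ) ^ 2 * C := by
  obtain ⟨c, hc⟩ := exists_dominating hm hd ha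
  have h := hc c le_rfl
  set G := diagInv d c
  set T := bandOp m a d hd ha with hT
  set T' := bandOp m a' d hd ha' with hT'
  have hmem : ∀ u, G u ∈ T.domain := fun u => (bandOp_domain hd ha).symm ▸ h.diagInv_mem u
  have hmem' : ∀ u, G u ∈ T'.domain := fun u => (bandOp_domain hd ha').symm ▸ h.diagInv_mem u
  have bdd_b : ∀ s, IsBdd (b s) := fun s => isBdd_of_support N (hN s)
  have bdd_e : ∀ s, IsBdd (e s) := fun s => isBdd_of_support N fun j hj => by
    rw [hbe, hN s j hj, zero_mul]
  -- These are the entries of (D + c) B (D + c)⁻¹, bounded since b vanishes beyond `N`; `hG` below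
  -- is the intertwining G B' = B G.
  let b' : ℤ → ℤ → ℝ := fun s j => b s j * (ext d j + c) * invWeight d c (j + s)
  have bdd_b' : ∀ s, IsBdd (b' s) := fun s => isBdd_of_support N fun j hj => by
    simp [b', hN s j hj]
  set B := bandCLM m b
  set B' := bandCLM m b'
  set E := bandCLM m e
  -- This is T G in bounded form; T' G is then P - E G.
  let P : Ell2 →L[ℂ] Ell2 := 1 - (c : ℂ) • G + relOffDiag m a d c
  have hP : ∀ u j, P u j = (d j : ℂ) * G u j +
      ∑ s ∈ shifts m, (bandCoeff a s j : ℂ) * ext (G u : ℕ+ → ℂ) ((j : ℤ) + s) := fun u j => by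
    rw [h.mul_diagInv_apply, ← h.relOffDiag_apply]
    rfl
  have hTG : ∀ u, T ⟨G u, hmem u⟩ = P u := fun u => by
    refine ell2_ext fun j => ?_
    rw [hP]
    exact bandOp_apply hd ha _ j
  have hTG' : ∀ u, T' ⟨G u, hmem' u⟩ = P u - E (G u) := fun u => by
    refine ell2_ext fun j => ?_
    rw [lp.coeFn_sub, Pi.sub_apply, hP, bandCLM_apply bdd_e, add_sub_assoc,
      ← Finset.sum_sub_distrib]
    refine (bandOp_apply hd ha' _ j).trans (congrArg _ (Finset.sum_congr rfl fun s hs => ?_))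
    rw [hae s hs]
    push_cast
    ring
  have hG : ∀ u, G (B' u) = B (G u) := fun u => by
    refine ell2_ext fun j => ?_
    rw [h.diagInv_apply, bandCLM_apply bdd_b', bandCLM_apply bdd_b, Finset.mul_sum]
    refine Finset.sum_congr rfl fun s _ => ?_
    rw [h.ext_diagInv]
    have hne : ((d j : ℂ) + c) ≠ 0 := by exact_mod_cast (h.pos j).ne'
    simp only [b', ext_coe]
    push_cast
    field_simp
  have hB : ∀ x y, ⟪B x, y⟫_ℂ = -⟪x, B y⟫_ℂ := inner_bandCLM_of_skew bdd_b hskew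
  have hZ : ∀ r ∈ Set.Icc (0 : ℝ) 1, ∀ u, ‖E (G u) + (P (B' u) - (r : ℂ) • E (G (B' u)))
      - B (P u - (r : ℂ) • E (G u))‖ ≤ 4 * (m : ℝ) ^ 2 * C * ‖G u‖ := by
    intro r hr u
    refine norm_le_of_double_shift (κ := fun s k j => (bandCoeff a s j - r * e s j) * b k (j + s) -
      b k j * (bandCoeff a s (j + k) - r * e s (j + k))) hC0 (hC r hr) fun j => ?_
    have hR : ∀ v (j : ℕ+), (P v - (r : ℂ) • E (G v)) j = (d j : ℂ) * G v j +
        ∑ s ∈ shifts m, ((bandCoeff a s j - r * e s j : ℝ) : ℂ) *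
          ext (G v : ℕ+ → ℂ) ((j : ℤ) + s) := fun v j => by
      rw [lp.coeFn_sub, Pi.sub_apply, lp.coeFn_smul, Pi.smul_apply, hP, bandCLM_apply bdd_e,
        smul_eq_mul, Finset.mul_sum, add_sub_assoc, ← Finset.sum_sub_distrib]
      congr 1
      refine Finset.sum_congr rfl fun s _ => ?_
      push_cast
      ring
    have hR' : ∀ v (i : ℤ), ext ((P v - (r : ℂ) • E (G v) : Ell2) : ℕ+ → ℂ) i =
        ((ext d i : ℝ) : ℂ) * ext (G v : ℕ+ → ℂ) i +
        ∑ s ∈ shifts m, ((bandCoeff a s i - r * e s i : ℝ) : ℂ) *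
          ext (G v : ℕ+ → ℂ) (i + s) := fun v i => by
      rcases ext_cases i with hi | ⟨k, rfl⟩
      · rw [ext_of_nonpos _ hi, ext_of_nonpos d hi, Finset.sum_eq_zero fun s _ => ?_]
        · simp
        · rw [he0 s i hi, bandCoeff_of_nonpos a (Or.inl hi)]
          simp
      · rw [ext_coe, ext_coe, ext_coe, hR]
    rw [lp.coeFn_sub, Pi.sub_apply, lp.coeFn_add, Pi.add_apply, hR, bandCLM_apply bdd_e,
      bandCLM_apply bdd_b, hG, bandCLM_apply bdd_b]
    have h1 : ((d j : ℝ) : ℂ) = ((ext d j : ℝ) : ℂ) := by rw [ext_coe]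
    have h2 : ∀ s, ext (B (G u) : ℕ+ → ℂ) ((j : ℤ) + s) =
        ∑ k ∈ shifts m, (b k (j + s) : ℂ) * ext (G u : ℕ+ → ℂ) ((j : ℤ) + s + k) := fun s =>
      ext_bandCLM bdd_b (fun s j hj => hb0 s j (Or.inl hj)) _ _
    refine (congrArg₂ HSub.hSub (congrArg₂ HAdd.hAdd rfl (congrArg₂ HAdd.hAdd
      (congrArg₂ HMul.hMul h1 rfl) (Finset.sum_congr rfl fun s _ => congrArg₂ HMul.hMul rfl (h2 s))))
      (Finset.sum_congr rfl fun s _ => congrArg₂ HMul.hMul rfl (hR' u _))).trans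
      ((sum_commutator_eq (S := shifts m) (D := fun i => ((ext d i : ℝ) : ℂ))
      (Y := ext (G u : ℕ+ → ℂ)) (b := fun s j => (b s j : ℂ)) (e := fun s j => (e s j : ℂ))
      (f := fun s j => ((bandCoeff a s j - r * e s j : ℝ) : ℂ)) (j := j) fun s => ?_).trans ?_)
    · rw [hbe]
      push_cast
      ring
    · refine Finset.sum_congr rfl fun s _ => Finset.sum_congr rfl fun k _ => ?_
      push_cast
      ring
  have hform := abs_form_exp_sub_le hG hB hZ
  have hnorm := norm_exp_intertwined hG hB
  have hinv := exp_exp_neg_apply B'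
  have dom : T.domain = diagDomain d := bandOp_domain hd ha
  have dom' : T'.domain = diagDomain d := bandOp_domain hd ha'
  let toU : T.domain →ₗ[ℂ] Ell2 := diagAdd d c ∘ₗ Submodule.inclusion dom.le
  let toU' : T'.domain →ₗ[ℂ] Ell2 := diagAdd d c ∘ₗ Submodule.inclusion dom'.le
  have htoU : ∀ x : T.domain, G (toU x) = x := fun x => h.diagInv_diagAdd ⟨x, dom.le x.2⟩
  have htoU' : ∀ x : T'.domain, G (toU' x) = x := fun x => h.diagInv_diagAdd ⟨x, dom'.le x.2⟩
  rw [abs_sub_le_iff, sub_le_iff_le_add', sub_le_iff_le_add']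
  constructor
  -- On the domain, G exp(B') (D + c) is exp(B), an isometry carrying the form of T to that of T' up
  -- to the commutator bound. The other inequality uses exp(-B).
  · let U : T'.domain →ₗ[ℂ] T.domain := LinearMap.codRestrict T.domain
      ((G.comp (NormedSpace.exp B')).toLinearMap ∘ₗ toU') fun x => hmem _
    refine hev.le_add (isSymm_bandOp hm hd ha) (isSymm_bandOp hm hd ha') hev' U (fun x => ?_)
      (fun x => ?_) n
    · exact (hnorm (toU' x)).trans (by rw [htoU'])
    · have h1 := (abs_le.1 (hform (toU' x))).2
      have h2 : T (U x) = P (NormedSpace.exp B' (toU' x)) := hTG _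
      have h3 : T' x = P (toU' x) - E (G (toU' x)) :=
        (congrArg T' (Subtype.ext (htoU' x).symm)).trans (hTG' (toU' x))
      rw [htoU'] at h1
      have h4 : (U x : Ell2) = G (NormedSpace.exp B' (toU' x)) := rfl
      rw [h2, h4, h3, htoU']
      linarith
  · let U : T.domain →ₗ[ℂ] T'.domain := LinearMap.codRestrict T'.domain
      ((G.comp (NormedSpace.exp (-B'))).toLinearMap ∘ₗ toU) fun x => hmem' _
    have hU : ∀ x, ‖(U x : Ell2)‖ = ‖(x : Ell2)‖ := fun x => by
      have h1 := hnorm (NormedSpace.exp (-B') (toU x))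
      rw [hinv, htoU] at h1
      exact h1.symm
    refine hev'.le_add (isSymm_bandOp hm hd ha') (isSymm_bandOp hm hd ha) hev U hU
      (fun x => ?_) n
    have h1 := (abs_le.1 (hform (NormedSpace.exp (-B') (toU x)))).1
    have h2 : T' (U x) = P (NormedSpace.exp (-B') (toU x)) - E (G (NormedSpace.exp (-B') (toU x))) :=
      hTG' _
    have h3 : T x = P (toU x) := (congrArg T (Subtype.ext (htoU x).symm)).trans (hTG (toU x))
    have h4 : (U x : Ell2) = G (NormedSpace.exp (-B') (toU x)) := rfl
    rw [hinv, htoU, ← h4, hU] at h1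
    rw [h2, h3, ← h4]
    linarith

end

/-! ### Maxima over windows and discrete Lipschitz bounds -/

section windows

variable {m : ℕ} {a : ℕ → ℕ+ → ℝ} {d : ℕ+ → ℝ} {S : ℕ} {j : ℤ}

theorem abs_ext_le_alpha {l : ℕ} (hl : l ∈ Finset.Icc 1 m) {i : ℤ} (h1 : j - S ≤ i)
    (h2 : i ≤ j + S) : |ext (a l) i| ≤ alpha m a S j := by
  have h := le_ciSup (f := fun p : Finset.Icc 1 m × Finset.Icc (-(S : ℤ)) S =>
    |ext (a p.1) (j + p.2)|) (Set.finite_range _).bddAbove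
    (⟨l, hl⟩, ⟨i - j, Finset.mem_Icc.2 ⟨by omega, by omega⟩⟩)
  simpa [alpha] using h

theorem add_abs_fdiff_le_alphaTilde {l : ℕ} (hl : l ∈ Finset.Icc 1 m) {i : ℤ} (h1 : j - S ≤ i)
    (h2 : i ≤ j + S) (t : ℕ+) :
    2 * alpha m a S j / t + |fdiff (ext (a l)) i| ≤ alphaTilde m a t S j := by
  have h := le_ciSup (f := fun p : Finset.Icc 1 m × Finset.Icc (-(S : ℤ)) S =>
    |fdiff (ext (a p.1)) (j + p.2)|) (Set.finite_range _).bddAbove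
    (⟨l, hl⟩, ⟨i - j, Finset.mem_Icc.2 ⟨by omega, by omega⟩⟩)
  simp only [add_sub_cancel] at h
  rw [alphaTilde]
  linarith

theorem gamma_le_fdiff {i : ℤ} (h1 : j - S - 1 ≤ i) (h2 : i ≤ j + S + 1) :
    gamma d S j ≤ fdiff (ext d) i := by
  have h := ciInf_le (f := fun i : Finset.Icc (-((S : ℤ) + 1)) ((S : ℤ) + 1) =>
    fdiff (ext d) (j + i)) (Set.finite_range _).bddBelow
    ⟨i - j, Finset.mem_Icc.2 ⟨by omega, by omega⟩⟩
  simpa [gamma] using h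

theorem gamma_pos (h : ∀ i, j - S - 1 ≤ i → 0 < fdiff (ext d) i) : 0 < gamma d S j := by
  have : Nonempty (Finset.Icc (-((S : ℤ) + 1)) ((S : ℤ) + 1)) :=
    ⟨0, Finset.mem_Icc.2 ⟨by omega, by omega⟩⟩
  obtain ⟨i, hi⟩ := exists_eq_ciInf_of_finite
    (f := fun i : Finset.Icc (-((S : ℤ) + 1)) ((S : ℤ) + 1) => fdiff (ext d) (j + i))
  rw [gamma, ← hi]
  have := Finset.mem_Icc.1 i.2
  exact h _ (by omega)

theorem abs_fdiff_fdiff_le_gammaTilde {i : ℤ} (h1 : j - S ≤ i) (h2 : i ≤ j + S) :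
    |fdiff (fdiff (ext d)) i| ≤ gammaTilde d S j := by
  have h := le_ciSup (f := fun i : Finset.Icc (-(S : ℤ)) S =>
    |fdiff (fdiff (ext d)) (j + i)|) (Set.finite_range _).bddAbove
    ⟨i - j, Finset.mem_Icc.2 ⟨by omega, by omega⟩⟩
  simpa [gammaTilde] using h

theorem alpha_nonneg : 0 ≤ alpha m a S j := Real.iSup_nonneg fun _ => abs_nonneg _

theorem alphaTilde_nonneg (t : ℕ+) : 0 ≤ alphaTilde m a t S j :=
  add_nonneg (div_nonneg (mul_nonneg zero_le_two alpha_nonneg) (by positivity))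
    (Real.iSup_nonneg fun _ => abs_nonneg _)

theorem gammaTilde_nonneg : 0 ≤ gammaTilde d S j := Real.iSup_nonneg fun _ => abs_nonneg _

theorem rho_nonneg (t : ℕ+) (h : 0 < gamma d (4 * m) j) : 0 ≤ rho m a d t j :=
  add_nonneg
    (mul_nonneg (mul_nonneg zero_le_two (alphaTilde_nonneg t)) (div_nonneg alpha_nonneg h.le))
    (mul_nonneg (mul_nonneg (Nat.cast_nonneg m) gammaTilde_nonneg)
      (div_nonneg (sq_nonneg _) (sq_nonneg _)))

end windows

theorem abs_add_natCast_sub_le {f : ℤ → ℝ} {M : ℝ} {x : ℤ} (k : ℕ)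
    (h : ∀ i, x ≤ i → i < x + k → |fdiff f i| ≤ M) : |f (x + k) - f x| ≤ k * M := by
  induction k with
  | zero => simp
  | succ k ih =>
    have h1 := ih fun i hi hi' => h i hi (by push_cast; omega)
    have h2 := h (x + k) (by omega) (by push_cast; omega)
    have h3 : f (x + (k + 1 : ℕ)) - f x = fdiff f (x + k) + (f (x + k) - f x) := by
      rw [fdiff]
      push_cast
      rw [add_assoc]
      ring
    rw [h3]
    push_cast
    linarith [abs_add_le (fdiff f (x + k)) (f (x + k) - f x)]

/-- A sequence with increments at most `M` on `[lo, hi)` is `M`-Lipschitz on `[lo, hi]`. -/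
theorem abs_sub_le_of_abs_fdiff_le {f : ℤ → ℝ} {M : ℝ} {lo hi : ℤ}
    (h : ∀ i, lo ≤ i → i < hi → |fdiff f i| ≤ M) {x y : ℤ} (hx : lo ≤ x) (hx' : x ≤ hi)
    (hy : lo ≤ y) (hy' : y ≤ hi) : |f y - f x| ≤ (y - x).natAbs * M := by
  rcases le_total x y with hxy | hxy
  · have h1 := abs_add_natCast_sub_le (f := f) (M := M) (x := x) (y - x).natAbs
      fun i h1 h2 => h i (by omega) (by omega)
    rwa [show x + ((y - x).natAbs : ℤ) = y by omega] at h1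
  · have h1 := abs_add_natCast_sub_le (f := f) (M := M) (x := y) (y - x).natAbs
      fun i h1 h2 => h i (by omega) (by omega)
    rwa [show y + ((y - x).natAbs : ℤ) = x by omega, abs_sub_comm] at h1

theorem le_add_natCast_sub {f : ℤ → ℝ} {g : ℝ} (hg : 0 ≤ g) {x : ℤ} {k : ℕ} (hk : 1 ≤ k)
    (h : ∀ i, x ≤ i → i < x + k → g ≤ fdiff f i) : g ≤ f (x + k) - f x := by
  induction k, hk using Nat.le_induction with
  | base => simpa [fdiff] using h x le_rfl (by simp)
  | succ k hk ih =>
    have h1 := ih fun i hi hi' => h i hi (by push_cast; omega)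
    have h2 := h (x + k) (by omega) (by push_cast; omega)
    rw [fdiff, add_assoc] at h2
    push_cast
    linarith

theorem lt_add_natCast {f : ℤ → ℝ} {x : ℤ} {k : ℕ} (hk : 1 ≤ k)
    (h : ∀ i, x ≤ i → 0 < fdiff f i) : f x < f (x + k) := by
  induction k, hk using Nat.le_induction with
  | base => simpa [fdiff] using h x le_rfl
  | succ k hk ih =>
    have h2 := h (x + k) (by omega)
    rw [fdiff, add_assoc] at h2
    push_cast
    linarith

/-! ### Commutator estimates -/

section estimates

variable {m : ℕ} {a : ℕ → ℕ+ → ℝ} {d : ℕ+ → ℝ} {t : ℕ+} {j : ℤ}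

/-- Coefficients multiplied by a slowly varying factor. -/
theorem abs_fdiff_mul_le {ψ : ℤ → ℝ} (hψ : ∀ i, |ψ i| ≤ 1) (hψ' : ∀ i, |fdiff ψ i| ≤ 2 / t)
    {l : ℕ} (hl : l ∈ Finset.Icc 1 m) {S : ℕ} {i : ℤ} (h1 : j - S ≤ i) (h2 : i < j + S) :
    |fdiff (fun i => ψ i * ext (a l) i) i| ≤ alphaTilde m a t S j := by
  have h3 : fdiff (fun i => ψ i * ext (a l) i) i =
      fdiff ψ i * ext (a l) (i + 1) + ψ i * fdiff (ext (a l)) i := by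
    simp only [fdiff]
    ring
  rw [h3]
  refine (abs_add_le _ _).trans (le_trans ?_ (add_abs_fdiff_le_alphaTilde hl h1 h2.le t))
  rw [abs_mul, abs_mul, mul_div_right_comm]
  exact add_le_add
    (mul_le_mul (hψ' i) (abs_ext_le_alpha hl (by omega) (by omega)) (abs_nonneg _) (by positivity))
    (mul_le_of_le_one_left (abs_nonneg _) (hψ i))

theorem abs_mul_ext_le {ψ : ℤ → ℝ} (hψ : ∀ i, |ψ i| ≤ 1)
    {l : ℕ} (hl : l ∈ Finset.Icc 1 m) {S : ℕ} {i : ℤ} (h1 : j - S ≤ i) (h2 : i ≤ j + S) :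
    |ψ i * ext (a l) i| ≤ alpha m a S j := by
  rw [abs_mul]
  exact (mul_le_of_le_one_left (abs_nonneg _) (hψ i)).trans (abs_ext_le_alpha hl h1 h2)

theorem gamma_le_sub (hγ : 0 < gamma d (4 * m) j) {l : ℕ} (hl : l ∈ Finset.Icc 1 m) {i : ℤ}
    (h1 : j - 2 * m ≤ i) (h2 : i ≤ j + 2 * m) :
    gamma d (4 * m) j ≤ ext d (i + l) - ext d i := by
  rw [Finset.mem_Icc] at hl
  exact le_add_natCast_sub hγ.le hl.1 fun k hk hk' =>
    gamma_le_fdiff (by push_cast; omega) (by push_cast; omega)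

theorem abs_div_sub_le {ψ : ℤ → ℝ} (hψ : ∀ i, |ψ i| ≤ 1) (hγ : 0 < gamma d (4 * m) j)
    {l : ℕ} (hl : l ∈ Finset.Icc 1 m) {i : ℤ} (h1 : j - 2 * m ≤ i) (h2 : i ≤ j + 2 * m) :
    |ψ i * ext (a l) i / (ext d (i + l) - ext d i)| ≤ alpha m a (4 * m) j / gamma d (4 * m) j := by
  have h3 := gamma_le_sub hγ hl h1 h2
  rw [abs_div, abs_of_pos (hγ.trans_le h3)]
  exact div_le_div₀ alpha_nonneg
    (abs_mul_ext_le hψ hl (by push_cast; omega) (by push_cast; omega)) hγ h3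

/-- Discrete quotient rule: q/x - p/y = (q - p)/x - p(x - y)/(xy). The change x - y of the
denominator is Δd(i + l) - Δd(i), a sum of l ≤ m second differences of d. -/
theorem abs_fdiff_div_sub_le {ψ : ℤ → ℝ} (hψ : ∀ i, |ψ i| ≤ 1) (hψ' : ∀ i, |fdiff ψ i| ≤ 2 / t)
    (hγ : 0 < gamma d (4 * m) j)
    {l : ℕ} (hl : l ∈ Finset.Icc 1 m) {i : ℤ} (h1 : j - 2 * m ≤ i) (h2 : i < j + 2 * m) :
    |fdiff (fun i => ψ i * ext (a l) i / (ext d (i + l) - ext d i)) i| ≤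
      alphaTilde m a t (4 * m) j / gamma d (4 * m) j +
        alpha m a (4 * m) j * (m * gammaTilde d (5 * m) j) / gamma d (4 * m) j ^ 2 := by
  have hl' := Finset.mem_Icc.1 hl
  have hD := gamma_le_sub hγ hl h1 h2.le
  have hD' := gamma_le_sub hγ hl (i := i + 1) (by omega) (by omega)
  have hp := abs_mul_ext_le (a := a) (j := j) (S := 4 * m) hψ hl (i := i)
    (by push_cast; omega) (by push_cast; omega)
  have hp' := abs_fdiff_mul_le (a := a) (j := j) (S := 4 * m) hψ hψ' hl (i := i)
    (by push_cast; omega) (by push_cast; omega)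
  have hdd : |(ext d (i + 1 + l) - ext d (i + 1)) - (ext d (i + l) - ext d i)| ≤
      m * gammaTilde d (5 * m) j := by
    have h3 := abs_add_natCast_sub_le (f := fdiff (ext d)) (M := gammaTilde d (5 * m) j) (x := i) l
      fun k hk hk' => abs_fdiff_fdiff_le_gammaTilde (by push_cast; omega) (by push_cast; omega)
    have h4 : (ext d (i + 1 + l) - ext d (i + 1)) - (ext d (i + l) - ext d i) =
        fdiff (ext d) (i + l) - fdiff (ext d) i := by
      simp only [fdiff]
      rw [add_right_comm]
      ring
    rw [h4]
    exact h3.trans (mul_le_mul_of_nonneg_right (by exact_mod_cast hl'.2) gammaTilde_nonneg)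
  simp only [fdiff] at hp' ⊢
  set γ := gamma d (4 * m) j
  set x := ext d (i + 1 + l) - ext d (i + 1)
  set y := ext d (i + l) - ext d i
  set p := ψ i * ext (a l) i
  set q := ψ (i + 1) * ext (a l) (i + 1)
  have hx : 0 < x := hγ.trans_le hD'
  have hy : 0 < y := hγ.trans_le hD
  have h5 : q / x - p / y = (q - p) / x - p * (x - y) / (x * y) := by
    field_simp
    ring
  rw [h5]
  refine (abs_sub _ _).trans (add_le_add ?_ ?_)
  · rw [abs_div, abs_of_pos hx]
    exact div_le_div₀ (alphaTilde_nonneg t) hp' hγ hD'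
  · rw [abs_div, abs_of_pos (mul_pos hx hy), abs_mul, pow_two]
    exact div_le_div₀ (mul_nonneg alpha_nonneg (mul_nonneg (Nat.cast_nonneg m) gammaTilde_nonneg))
      (mul_le_mul hp hdd (abs_nonneg _) alpha_nonneg) (mul_pos hγ hγ)
      (mul_le_mul hD' hD hγ.le hx.le)

/-- The entry `(j, j + s)` of the off-diagonal part, localized by `φ`. -/
def innerCoeff (m : ℕ) (φ : ℤ → ℝ) (a : ℕ → ℕ+ → ℝ) (s j : ℤ) : ℝ :=
  if s ∈ shifts m then φ (min j (j + s)) * bandCoeff a s j else 0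

/-- The entry `(j, j + s)` of the solution `B` of `[D, B] = -E`, where `E` is the localized
off-diagonal part. -/
def conjCoeff (m : ℕ) (φ : ℤ → ℝ) (a : ℕ → ℕ+ → ℝ) (d : ℕ+ → ℝ) (s j : ℤ) : ℝ :=
  innerCoeff m φ a s j / (ext d (j + s) - ext d j)

/-- The index j + min 0 s is the smaller of j and j + s. For s < 0 the denominator reverses sign, so
up to a constant sign each diagonal of B is a translate of one fixed sequence, to which the
Lipschitz bounds apply. -/
theorem conjCoeff_eq {φ : ℤ → ℝ} {s : ℤ} (hs : s ∈ shifts m) : ∃ σ : ℝ, |σ| = 1 ∧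
    ∀ j, conjCoeff m φ a d s j = σ * ((fun i => φ i * ext (a s.natAbs) i /
      (ext d (i + s.natAbs) - ext d i)) (j + min 0 s)) := by
  rcases le_total 0 s with h | h
  · refine ⟨1, by simp, fun j => ?_⟩
    have h1 : min j (j + s) = j := by omega
    have h2 : (s.natAbs : ℤ) = s := by omega
    simp only [conjCoeff, innerCoeff, bandCoeff, if_pos hs, h1, min_eq_left h, add_zero, one_mul,
      h2]
  · refine ⟨-1, by simp, fun j => ?_⟩
    have h1 : min j (j + s) = j + s := by omega
    have h2 : j + s + (s.natAbs : ℤ) = j := by omega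
    simp only [conjCoeff, innerCoeff, bandCoeff, if_pos hs, h1, min_eq_right h, h2]
    rw [← neg_sub (ext d j), div_neg]
    ring

/-- The commutator entries are bounded by `m ρ`. -/
theorem abs_commutator_le {φ : ℤ → ℝ} (hφ : ∀ i, φ i ∈ Set.Icc (0 : ℝ) 1)
    (hφ' : ∀ i, |fdiff φ i| ≤ 2 / t) (hγ : 0 < gamma d (4 * m) j) {r : ℝ}
    (hr : r ∈ Set.Icc (0 : ℝ) 1) {s k : ℤ} (hs : s ∈ shifts m) (hk : k ∈ shifts m) :
    |(bandCoeff a s j - r * innerCoeff m φ a s j) * conjCoeff m φ a d k (j + s) -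
      conjCoeff m φ a d k j * (bandCoeff a s (j + k) - r * innerCoeff m φ a s (j + k))| ≤
      m * rho m a d t j := by
  obtain ⟨σ, hσ, hb⟩ := conjCoeff_eq (φ := φ) (a := a) (d := d) hk
  have hs' := mem_shifts.1 hs
  have hk' := mem_shifts.1 hk
  have hs2 := Finset.mem_Icc.1 hs'
  have hk2 := Finset.mem_Icc.1 hk'
  set h : ℤ → ℝ := fun i => φ i * ext (a k.natAbs) i / (ext d (i + k.natAbs) - ext d i)
  -- The off-diagonal part A' - rE has coefficients ψ a_l, and ψ inherits from φ the bound 1 and the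
  -- Lipschitz constant 2/t.
  let ψ : ℤ → ℝ := fun i => 1 - r * φ i
  let q : ℤ → ℝ := fun i => ψ i * ext (a s.natAbs) i
  have hφ1 : ∀ i, |φ i| ≤ 1 := fun i => by
    rw [abs_of_nonneg (hφ i).1]
    exact (hφ i).2
  have hψ : ∀ i, |ψ i| ≤ 1 := fun i => by
    have h1 := mul_nonneg hr.1 (hφ i).1
    have h2 := mul_le_one₀ hr.2 (hφ i).1 (hφ i).2
    rw [abs_le]
    constructor <;> simp only [ψ] <;> linarith
  have hψ' : ∀ i, |fdiff ψ i| ≤ 2 / t := fun i => by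
    have h1 : fdiff ψ i = -(r * fdiff φ i) := by
      simp only [fdiff, ψ]
      ring
    rw [h1, abs_neg, abs_mul, abs_of_nonneg hr.1]
    exact (mul_le_of_le_one_left (abs_nonneg _) hr.2).trans (hφ' i)
  have hq : ∀ i, bandCoeff a s i - r * innerCoeff m φ a s i = q (i + min 0 s) := fun i => by
    have h1 : min i (i + s) = i + min 0 s := by omega
    simp only [innerCoeff, bandCoeff, if_pos hs, h1, q, ψ]
    ring
  set α := alpha m a (4 * m) j
  set α' := alphaTilde m a t (4 * m) j
  set γ := gamma d (4 * m) j
  set γ' := gammaTilde d (5 * m) j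
  have hα : 0 ≤ α := alpha_nonneg
  have hα' : 0 ≤ α' := alphaTilde_nonneg t
  have hγ' : 0 ≤ γ' := gammaTilde_nonneg
  set M := α' / γ + α * (m * γ') / γ ^ 2 with hM
  have hM0 : 0 ≤ M := by positivity
  have e1 : |q (j + min 0 s)| ≤ α := abs_mul_ext_le hψ hs' (by push_cast; omega) (by push_cast; omega)
  have e2 : |q (j + k + min 0 s) - q (j + min 0 s)| ≤ m * α' := by
    refine (abs_sub_le_of_abs_fdiff_le (lo := j - 2 * m) (hi := j + 2 * m) (M := α')
      (fun i h1 h2 => abs_fdiff_mul_le hψ hψ' hs' (by push_cast; omega) (by push_cast; omega))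
      (by omega) (by omega) (by omega) (by omega)).trans ?_
    refine mul_le_mul_of_nonneg_right ?_ hα'
    rw [show j + k + min 0 s - (j + min 0 s) = k by ring]
    exact_mod_cast hk2.2
  have e3 : |h (j + min 0 k)| ≤ α / γ := abs_div_sub_le hφ1 hγ hk' (by omega) (by omega)
  have e4 : |h (j + s + min 0 k) - h (j + min 0 k)| ≤ m * M := by
    refine (abs_sub_le_of_abs_fdiff_le (lo := j - 2 * m) (hi := j + 2 * m) (M := M)
      (fun i h1 h2 => abs_fdiff_div_sub_le hφ1 hφ' hγ hk' h1 h2)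
      (by omega) (by omega) (by omega) (by omega)).trans ?_
    refine mul_le_mul_of_nonneg_right ?_ hM0
    rw [show j + s + min 0 k - (j + min 0 k) = s by ring]
    exact_mod_cast hs2.2
  rw [hb, hb, hq, hq]
  -- Discrete product rule: each factor is shifted by at most m, and the shift acts on one factor at
  -- a time.
  have e5 : q (j + min 0 s) * (σ * h (j + s + min 0 k)) -
      σ * h (j + min 0 k) * q (j + k + min 0 s) =
      σ * (q (j + min 0 s) * (h (j + s + min 0 k) - h (j + min 0 k)) -
        h (j + min 0 k) * (q (j + k + min 0 s) - q (j + min 0 s))) := by ring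
  rw [e5, abs_mul, hσ, one_mul]
  refine (abs_sub _ _).trans ?_
  rw [abs_mul (q _), abs_mul (h _)]
  -- The term αα'/γ arises twice, from varying the numerator of h and from varying q; this is the
  -- factor 2 in ρ.
  have e6 : m * rho m a d t j = α * (m * M) + α / γ * (m * α') := by
    rw [rho, hM]
    change (m : ℝ) * (2 * α' * (α / γ) + m * γ' * (α ^ 2 / γ ^ 2)) = _
    field_simp
    ring
  rw [e6]
  exact add_le_add (mul_le_mul e1 e4 (abs_nonneg _) hα)
    (mul_le_mul e3 e2 (abs_nonneg _) (div_nonneg hα hγ.le))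

end estimates

/-! ### Localization near n and the final estimate -/

theorem IsCutoff.abs_sub_le {χ : ℝ → ℝ} (hχ : IsCutoff χ) (x y : ℝ) :
    |χ y - χ x| ≤ 2 * |y - x| :=
  convex_univ.norm_image_sub_le_of_norm_deriv_le
    (fun x _ => (hχ.contDiff.differentiable one_ne_zero) x) (fun x _ => hχ.abs_deriv_le x)
    (Set.mem_univ x) (Set.mem_univ y)

/-- The estimate for a single index `n`, when `d` is increasing on the relevant window. -/
theorem abs_eigenvalue_sub_outer_le {m : ℕ} (hm : 1 ≤ m) {a : ℕ → ℕ+ → ℝ} {d : ℕ+ → ℝ}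
    (hd : Tendsto d atTop atTop) (ha : OffDiagSmall m a d) {χ : ℝ → ℝ} (hχ : IsCutoff χ)
    {n t : ℕ+} (hmono : ∀ i : ℤ, (n : ℤ) - 2 * t - 6 * m - 1 ≤ i → 0 < fdiff (ext d) i)
    {ev ev' : ℕ+ → ℝ} (hev : IsEigenvalueSequence (bandOp m a d hd ha) ev)
    (hev' : IsEigenvalueSequence (outerOp m a d hd ha χ hχ n t) ev') (k : ℕ+) :
    |ev k - ev' k| ≤ 15 * (m : ℝ) ^ 3 *
      ⨆ i : Finset.Icc (-(2 * (t : ℤ) + 4 * m)) (2 * (t : ℤ) + 4 * m),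
        rho m a d t ((n : ℤ) + i) := by
  set ρ := ⨆ i : Finset.Icc (-(2 * (t : ℤ) + 4 * m)) (2 * (t : ℤ) + 4 * m),
    rho m a d t ((n : ℤ) + i)
  have hm0 : (0 : ℝ) ≤ m := Nat.cast_nonneg m
  have ht : (0 : ℝ) < t := by exact_mod_cast t.pos
  have hle : ∀ j : ℤ, (n : ℤ) - 2 * t - 2 * m ≤ j → j ≤ n + 2 * t + 2 * m →
      rho m a d t j ≤ ρ := fun j h1 h2 => by
    have h := le_ciSup (f := fun i : Finset.Icc (-(2 * (t : ℤ) + 4 * m)) (2 * (t : ℤ) + 4 * m) =>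
      rho m a d t ((n : ℤ) + i)) (Set.finite_range _).bddAbove
      ⟨j - n, Finset.mem_Icc.2 ⟨by omega, by omega⟩⟩
    simpa using h
  -- The window of γ reaches 4m + 1 below j ≥ n - 2t - 2m, which explains the 6m + 1 in `hmono`.
  have hγ : ∀ j : ℤ, (n : ℤ) - 2 * t - 2 * m ≤ j → 0 < gamma d (4 * m) j := fun j hj =>
    gamma_pos fun i hi => hmono i (by push_cast at hi; omega)
  have hρ0 : 0 ≤ ρ := (rho_nonneg t (hγ n (by omega))).trans (hle n (by omega) (by omega))
  let φ : ℤ → ℝ := fun i => χ (((i : ℝ) - (n : ℝ)) / (t : ℝ))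
  have hφ : ∀ i, φ i ∈ Set.Icc (0 : ℝ) 1 := fun i => ⟨hχ.nonneg _, hχ.le_one _⟩
  have hφ' : ∀ i, |fdiff φ i| ≤ 2 / t := fun i => by
    refine (hχ.abs_sub_le _ _).trans (le_of_eq ?_)
    rw [← sub_div]
    push_cast
    rw [show (i : ℝ) + 1 - n - (i - n) = 1 by ring, abs_of_pos (by positivity)]
    ring
  have hφ0 : ∀ i : ℤ, (i < n - 2 * t ∨ n + 2 * t < i) → φ i = 0 := fun i hi => by
    refine hχ.eq_zero _ fun h => ?_
    rw [Set.mem_Icc, le_div_iff₀ ht, div_le_iff₀ ht] at h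
    have h1 : -2 * (t : ℤ) ≤ i - n := by exact_mod_cast h.1
    have h2 : i - (n : ℤ) ≤ 2 * t := by exact_mod_cast h.2
    omega
  have he0 : ∀ s j : ℤ, (min j (j + s) < n - 2 * t ∨ n + 2 * t < min j (j + s)) →
      innerCoeff m φ a s j = 0 := fun s j h => by
    rw [innerCoeff, hφ0 _ h, zero_mul, ite_self]
  have he1 : ∀ s j : ℤ, (j ≤ 0 ∨ j + s ≤ 0) → innerCoeff m φ a s j = 0 := fun s j h => by
    rw [innerCoeff, bandCoeff_of_nonpos a h, mul_zero, ite_self]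
  have hb_zero : ∀ s j : ℤ, innerCoeff m φ a s j = 0 → conjCoeff m φ a d s j = 0 :=
    fun s j h => by rw [conjCoeff, h, zero_div]
  have hsymm : ∀ s j, innerCoeff m φ a (-s) (j + s) = innerCoeff m φ a s j := fun s j => by
    rw [innerCoeff, innerCoeff, bandCoeff_neg]
    simp only [neg_mem_shifts]
    rw [show min (j + s) (j + s + -s) = min j (j + s) by omega]
  have h := abs_eigenvalue_sub_le hm hd ha (hχ.offDiagSmall_outerCoeff ha n t)
    (e := innerCoeff m φ a) (b := conjCoeff m φ a d) (N := n + 2 * t + m) (C := m * ρ)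
    (fun s hs j => ?_) (fun s j hj => he1 s j (Or.inl hj)) (fun s j hj => hb_zero s j (he1 s j hj))
    (fun s j => ?_) (fun s j => ?_) (fun s j hj => ?_) (mul_nonneg hm0 hρ0)
    (fun r hr s hs k hk j => ?_) hev hev' k
  -- The bound obtained is 4m²·mρ = 4m³ρ, well within 15m³ρ.
  · refine h.trans ?_
    have h1 : 0 ≤ (m : ℝ) ^ 3 * ρ := by positivity
    nlinarith
  · rw [innerCoeff, if_pos hs, bandCoeff, bandCoeff]
    rcases ext_cases (min j (j + s)) with h | ⟨k, hk⟩
    · simp [ext_of_nonpos _ h]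
    · simp only [← hk, ext_coe, outerCoeff, φ]
      push_cast
      ring
  -- A nonzero entry has its smaller index in the region where d is strictly increasing, so the
  -- denominator is nonzero; a zero entry makes both sides zero whatever the denominator.
  · by_cases h0 : innerCoeff m φ a s j = 0
    · rw [hb_zero s j h0, h0, zero_mul]
    · refine (div_mul_cancel₀ _ ?_).symm
      have hs : s ∈ shifts m := by
        by_contra hs
        exact h0 (if_neg hs)
      have hs1 := Finset.mem_Icc.1 (mem_shifts.1 hs)
      have hmin : (n : ℤ) - 2 * t ≤ min j (j + s) := by
        by_contra hlt
        exact h0 (he0 s j (Or.inl (not_le.1 hlt)))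
      have hlt := lt_add_natCast (f := ext d) (x := min j (j + s)) hs1.1
        fun i hi => hmono i (by omega)
      rcases le_total 0 s with h | h
      · rw [show min j (j + s) + (s.natAbs : ℤ) = j + s by omega,
          show min j (j + s) = j by omega] at hlt
        exact (sub_pos.2 hlt).ne'
      · rw [show min j (j + s) + (s.natAbs : ℤ) = j by omega,
          show min j (j + s) = j + s by omega] at hlt
        exact (sub_neg.2 hlt).ne
  · rw [conjCoeff, conjCoeff, hsymm, add_neg_cancel_right, ← neg_sub (ext d (j + s)), div_neg]
  · refine hb_zero s j ?_
    by_cases hs : s ∈ shifts m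
    · have hs1 := Finset.mem_Icc.1 (mem_shifts.1 hs)
      exact he0 s j (Or.inr (by omega))
    · exact if_neg hs
  · have hs1 := Finset.mem_Icc.1 (mem_shifts.1 hs)
    have hk1 := Finset.mem_Icc.1 (mem_shifts.1 hk)
    -- Outside this window both entries of B in the commutator vanish, because their smaller indices
    -- differ from j by at most 2m.
    by_cases hj : (n : ℤ) - 2 * t - 2 * m ≤ j ∧ (j : ℤ) ≤ n + 2 * t + 2 * m
    · exact (abs_commutator_le hφ hφ' (hγ j hj.1) hr hs hk).trans
        (mul_le_mul_of_nonneg_left (hle j hj.1 hj.2) hm0)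
    · rw [hb_zero k j (he0 k j (by omega)), hb_zero k (j + s) (he0 k (j + s) (by omega)), mul_zero,
        zero_mul, sub_zero, abs_zero]
      exact mul_nonneg hm0 hρ0

end BandMatrix

end

theorem theorem5p1 (m : ℕ) (hm : 1 ≤ m) (a : ℕ → ℕ+ → ℝ) (d : ℕ+ → ℝ)
    (hd : Tendsto d atTop atTop) (ha : BandMatrix.OffDiagSmall m a d)
    (hdmono : ∀ᶠ n : ℕ+ in atTop, d n < d (n + 1))
    (τ : ℕ+ → ℕ+) (hτmono : ∀ n, τ n ≤ τ (n + 1)) (hτ : Tendsto τ atTop atTop)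
    (hτn : Tendsto (fun n : ℕ+ => (n : ℤ) - 2 * (τ n : ℤ)) atTop atTop)
    (χ : ℝ → ℝ) (hχ : BandMatrix.IsCutoff χ)
    (hdiag : ∀ᶠ n : ℕ+ in atTop,
      d n = BandMatrix.eigenvalue (BandMatrix.outerOp m a d hd ha χ hχ n (τ n)) n) :
    BandMatrix.IsEigenvalueSequence (BandMatrix.bandOp m a d hd ha)
        (BandMatrix.eigenvalue (BandMatrix.bandOp m a d hd ha)) ∧
      ∃ n₁ : ℕ+, ∀ n ≥ n₁,
        |BandMatrix.eigenvalue (BandMatrix.bandOp m a d hd ha) n - d n| ≤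
          15 * (m : ℝ) ^ 3 *
            ⨆ i : Finset.Icc (-(2 * (τ n : ℤ) + 4 * m)) (2 * (τ n : ℤ) + 4 * m),
              BandMatrix.rho m a d (τ n) ((n : ℤ) + i) := by
  have hev := BandMatrix.isEigenvalueSequence_eigenvalue
    (BandMatrix.exists_isEigenvalueSequence hm hd ha)
  refine ⟨hev, ?_⟩
  obtain ⟨N, hN⟩ := eventually_atTop.1 hdmono
  -- Beyond `n₁` every index at which monotonicity of d is used is at least N, hence also positive.
  obtain ⟨n₁, hn₁⟩ := eventually_atTop.1
    (hdiag.and (hτn.eventually_ge_atTop ((N : ℤ) + 6 * m + 1)))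
  refine ⟨n₁, fun n hn => ?_⟩
  obtain ⟨h1, h2⟩ := hn₁ n hn
  have hev' := BandMatrix.isEigenvalueSequence_eigenvalue (BandMatrix.exists_isEigenvalueSequence
    hm hd (hχ.offDiagSmall_outerCoeff ha n (τ n)))
  have h3 := BandMatrix.abs_eigenvalue_sub_outer_le hm hd ha hχ (n := n) (t := τ n)
    (fun i hi => ?_) hev hev' n
  · rw [h1]
    exact h3
  · rcases BandMatrix.ext_cases i with h | ⟨k, rfl⟩
    · have := N.pos
      omega
    · have hk : N ≤ k := by
        have : (N : ℤ) ≤ k := by omega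
        exact_mod_cast this
      have h4 : BandMatrix.ext d ((k : ℤ) + 1) = d (k + 1) := by
        rw [← BandMatrix.ext_coe d (k + 1)]
        push_cast
        rfl
      rw [BandMatrix.fdiff, h4, BandMatrix.ext_coe]
      exact sub_pos.2 (hN k hk)
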